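/- Let $D_\infty=\langle a,b\mid a^2=b^2=1\rangle$ be the infinite dihedral group, regarded as a structure for the language of groups $\{\cdot,{}^{-1},1\}$. Then: 1. $D_\infty$ has a computable $d$-$\Sigma_2$ Scott sentence. That is, there is a sentence $\varphi=\sigma\wedge\pi$, where $\sigma$ is a computable (infinitary) $\Sigma_2$ sentence and $\pi$ is a computable (infinitary) $\Pi_2$ sentence in the language of groups, such that a countable structure for this language is a model of $\varphi$ if and only if it is isomorphic to $D_\infty$. 2. The index set $I(D_\infty)$ is $m$-complete $d$-$\Sigma^0_2$. That is, $I(D_\infty)$ is a difference of two $\Sigma^0_2$ sets, and every difference of two $\Sigma^0_2$ subsets of $\mathbb{N}$ is many-one reducible to $I(D_\infty)$. Here a formula is computable $\Sigma_0$, and computable $\Pi_0$, if it is finitary and quantifier-free, with negations only next to atomic formulas. For $n>0$, a computable $\Sigma_n$ formula $\psi(\bar x)$ is a c.e. disjunction of formulas $(\exists\bar y)\,\theta(\bar x,\bar y)$, and a computable $\Pi_n$ formula is a c.e. conjunction of formulas $(\forall\bar y)\,\theta(\bar x,\bar y)$, where each $\theta$ is computable $\Pi_k$, respectively computable $\Sigma_k$,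 for some $k<n$ (c.e. in terms of indices of the formulas). The index set $I(D_\infty)$ is the set of all $e\in\mathbb{N}$ such that the partial computable function $\varphi_e$ is the characteristic function of the atomic diagram $D(\mathcal B)$, coded by Gödel numbers, of some structure $\mathcal B\cong D_\infty$ whose universe is a subset of $\mathbb{N}$. -/

import Mathlib

universe u v

namespace ScottDihedral

open FirstOrder

/-! ### The language of groups and the infinite dihedral group -/

/-- The symbols of the language of groups: a constant for the identity, a unary symbol for the
inverse and a binary symbol for the product. -/
inductive GroupFunc : ℕ → Type
  | one : GroupFunc 0
  | inv : GroupFunc 1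
  | mul : GroupFunc 2

/-- The language of groups. It has no relation symbol, so that its atomic formulas are the
equations between terms. -/
abbrev groupLang : FirstOrder.Language.{0, 0} := ⟨GroupFunc, fun _ => Empty⟩

/-- A group, seen as a structure for the language of groups. -/
@[reducible]
def groupStructure (G : Type*) [Group G] : groupLang.Structure G where
  funMap := fun f x => match f, x with
    | GroupFunc.one, _ => 1
    | GroupFunc.inv, x => (x 0)⁻¹
    | GroupFunc.mul, x => x 0 * x 1
  RelMap := fun r _ => r.elim

/-- The infinite dihedral group `⟨a, b ∣ a² = b² = 1⟩`, with `a` and `b` the generators numbered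
`0` and `1`. -/
abbrev DInfty : Type :=
  PresentedGroup ({FreeGroup.of 0 ^ 2, FreeGroup.of 1 ^ 2} : Set (FreeGroup (Fin 2)))

instance : groupLang.Structure DInfty := groupStructure DInfty

/-! ### Gödel numbers -/

/-- The Gödel number of a term whose variables (or constants) are numbered by `ℕ`. -/
def termCode : groupLang.Term ℕ → ℕ
  | .var i => Nat.pair 0 i
  | .func GroupFunc.one _ => Nat.pair 1 0
  | .func GroupFunc.inv ts => Nat.pair 2 (termCode (ts 0))
  | .func GroupFunc.mul ts => Nat.pair 3 (Nat.pair (termCode (ts 0)) (termCode (ts 1)))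

/-- Finitary quantifier-free formulas with free variables `x₀, …, x_{m-1}`, in normal form:
negations occur only next to atomic formulas. -/
inductive QF (m : ℕ) : Type
  | eq (s t : groupLang.Term (Fin m)) : QF m
  | ne (s t : groupLang.Term (Fin m)) : QF m
  | and (φ ψ : QF m) : QF m
  | or (φ ψ : QF m) : QF m

/-- The Gödel number of the equation `s = t`. -/
def eqCode (s t : groupLang.Term ℕ) : ℕ :=
  Nat.pair 0 (Nat.pair (termCode s) (termCode t))

/-- The Gödel number of the negated equation `s ≠ t`. -/
def neCode (s t : groupLang.Term ℕ) : ℕ :=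
  Nat.pair 1 (Nat.pair (termCode s) (termCode t))

/-- The Gödel number of a quantifier-free formula; the variable `xᵢ` has number `i`. -/
def QF.code {m : ℕ} : QF m → ℕ
  | .eq s t => eqCode (s.relabel Fin.val) (t.relabel Fin.val)
  | .ne s t => neCode (s.relabel Fin.val) (t.relabel Fin.val)
  | .and φ ψ => Nat.pair 2 (Nat.pair φ.code ψ.code)
  | .or φ ψ => Nat.pair 3 (Nat.pair φ.code ψ.code)

theorem termCode_injective : Function.Injective termCode := by
  intro s
  induction s with
  | var i =>
    intro t h
    match t with
    | .var j => simpa [termCode] using h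
    | .func GroupFunc.one _ => simp [termCode] at h
    | .func GroupFunc.inv _ => simp [termCode] at h
    | .func GroupFunc.mul _ => simp [termCode] at h
  | func f ts ih =>
    intro t h
    match f, ts, ih, t with
    | GroupFunc.one, ts, ih, .var j => simp [termCode] at h
    | GroupFunc.one, ts, ih, .func GroupFunc.one us =>
      congr 1
      exact Subsingleton.elim _ _
    | GroupFunc.one, ts, ih, .func GroupFunc.inv _ => simp [termCode] at h
    | GroupFunc.one, ts, ih, .func GroupFunc.mul _ => simp [termCode] at h
    | GroupFunc.inv, ts, ih, .var j => simp [termCode] at h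
    | GroupFunc.inv, ts, ih, .func GroupFunc.one us => simp [termCode] at h
    | GroupFunc.inv, ts, ih, .func GroupFunc.inv us =>
      congr 1
      funext i
      fin_cases i
      apply ih
      simpa [termCode] using h
    | GroupFunc.inv, ts, ih, .func GroupFunc.mul _ => simp [termCode] at h
    | GroupFunc.mul, ts, ih, .var j => simp [termCode] at h
    | GroupFunc.mul, ts, ih, .func GroupFunc.one us => simp [termCode] at h
    | GroupFunc.mul, ts, ih, .func GroupFunc.inv us => simp [termCode] at h
    | GroupFunc.mul, ts, ih, .func GroupFunc.mul us =>
      simp only [termCode, Nat.pair_eq_pair, true_and] at h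
      congr 1
      funext i
      fin_cases i
      · exact ih _ h.1
      · exact ih _ h.2

theorem QF.code_injective {m : ℕ} : Function.Injective (QF.code (m := m)) := by
  have rel : Function.Injective (fun s : groupLang.Term (Fin m) => termCode (s.relabel Fin.val)) := by
    apply termCode_injective.comp
    intro s
    induction s with
    | var i => rintro (j | ⟨f, us⟩) h <;> simp [FirstOrder.Language.Term.relabel, Fin.ext_iff] at h ⊢; exact h
    | func f ts ih =>
      rintro (j | ⟨g, us⟩) h
      · simp [FirstOrder.Language.Term.relabel] at h
      · simp only [FirstOrder.Language.Term.relabel, FirstOrder.Language.Term.func.injEq] at h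
        obtain ⟨rfl, h1, h2⟩ := h
        cases h1
        congr 1; funext i
        exact ih i (congrFun (eq_of_heq h2) i)
  intro φ
  induction φ with
  | eq s t | ne s t =>
    intro χ h; cases χ <;> simp [QF.code, eqCode, neCode] at h ⊢
    exact ⟨rel h.1, rel h.2⟩
  | and a b iha ihb | or a b iha ihb =>
    intro χ h; cases χ <;> simp [QF.code, eqCode, neCode] at h ⊢
    exact ⟨iha h.1, ihb h.2⟩

/-! ### Infinitary formulas -/

/-- Formulas of `L_{ω₁ω}` in normal form, in the language of groups, with free variables
`x₀, …, x_{m-1}`. Here `exDisj S k ψ` is the countable disjunction over `c ∈ S` of the formulas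
`∃ y₁ … y_{k c}, ψ c`, the free variables of `ψ c` being `x₀, …, x_{m-1}, y₁, …, y_{k c}`, and
`allConj S k ψ` is the countable conjunction over `c ∈ S` of the formulas `∀ y₁ … y_{k c}, ψ c`. -/
inductive InfFormula : ℕ → Type
  | qf {m : ℕ} (φ : QF m) : InfFormula m
  | exDisj {m : ℕ} (S : Set ℕ) (k : S → ℕ) (ψ : (c : S) → InfFormula (m + k c)) : InfFormula m
  | allConj {m : ℕ} (S : Set ℕ) (k : S → ℕ) (ψ : (c : S) → InfFormula (m + k c)) : InfFormula m
  | and {m : ℕ} (φ ψ : InfFormula m) : InfFormula m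

section Satisfaction

variable (M : Type*) [groupLang.Structure M]

/-- Satisfaction of a quantifier-free formula by a tuple. -/
def QF.Sat {m : ℕ} : QF m → (Fin m → M) → Prop
  | .eq s t, v => s.realize v = t.realize v
  | .ne s t, v => s.realize v ≠ t.realize v
  | .and φ ψ, v => φ.Sat v ∧ ψ.Sat v
  | .or φ ψ, v => φ.Sat v ∨ ψ.Sat v

/-- Satisfaction of an infinitary formula by a tuple. -/
def InfFormula.Sat : {m : ℕ} → InfFormula m → (Fin m → M) → Prop
  | _, .qf φ, v => φ.Sat M v
  | _, .exDisj _ k ψ, v => ∃ c, ∃ y : Fin (k c) → M, (ψ c).Sat (Fin.append v y)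
  | _, .allConj _ k ψ, v => ∀ c, ∀ y : Fin (k c) → M, (ψ c).Sat (Fin.append v y)
  | _, .and φ ψ, v => φ.Sat v ∧ ψ.Sat v

end Satisfaction

/-- `M` is a model of the sentence `φ`. -/
def InfFormula.Holds (φ : InfFormula 0) (M : Type*) [groupLang.Structure M] : Prop :=
  φ.Sat M Fin.elim0

/-- `φ` is a Scott sentence for `A`: its countable models are exactly the isomorphic copies of the
countable structure `A`. -/
def IsScottSentence (φ : InfFormula 0) (A : Type v) [groupLang.Structure A] : Prop :=
  Countable A ∧ ∀ (M : Type u) [groupLang.Structure M] [Countable M],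
    φ.Holds M ↔ Nonempty (M ≃[groupLang] A)

/-! ### Computable infinitary formulas -/

/-- The partial computable function `φ_e`, in the numbering given by Gödel numbers of programs. -/
def phi (e : ℕ) : ℕ →. ℕ := (Denumerable.ofNat Nat.Partrec.Code e).eval

/-- The c.e. set `W_e`, the domain of `φ_e`. -/
def W (e : ℕ) : Set ℕ := {c | (phi e c).Dom}

/-- The component `b` of `c = ⟨b, ⟨k, i⟩⟩`. -/
def levelOf (c : ℕ) : ℕ := c.unpair.1

/-- The component `k` of `c = ⟨b, ⟨k, i⟩⟩`. -/
def arityOf (c : ℕ) : ℕ := c.unpair.2.unpair.1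

/-- The component `i` of `c = ⟨b, ⟨k, i⟩⟩`. -/
def indexOf (c : ℕ) : ℕ := c.unpair.2.unpair.2

/-- The two sides of the hierarchy of computable infinitary formulas. -/
inductive Side : Type
  | sigma : Side
  | pi : Side

/-- `HasIndex s n e φ` says that `e` is an index of `φ` as a computable `Σ_n` (`s = sigma`) or
computable `Π_n` (`s = pi`) formula. At level `0` the formula is finitary and quantifier-free and
`e` is its Gödel number. At level `n + 1` on the `Σ` side, `φ` is the disjunction, over the
elements `c = ⟨b, ⟨k, i⟩⟩` of the c.e. set `W_e`, of formulas `∃ y₁ … y_k, ψ`, where `b < n + 1`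
and `i` is an index of `ψ` as a computable `Π_b` formula; the `Π` side is dual. -/
inductive HasIndex : Side → ℕ → {m : ℕ} → ℕ → InfFormula m → Prop
  | qf (s : Side) {m : ℕ} (φ : QF m) : HasIndex s 0 φ.code (.qf φ)
  | exDisj (n : ℕ) {m : ℕ} (e : ℕ) (ψ : (c : W e) → InfFormula (m + arityOf c))
      (hlevel : ∀ c : W e, levelOf c < n + 1)
      (hindex : ∀ c : W e, HasIndex .pi (levelOf c) (indexOf c) (ψ c)) :
      HasIndex .sigma (n + 1) e (.exDisj (W e) (fun c => arityOf c) ψ)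
  | allConj (n : ℕ) {m : ℕ} (e : ℕ) (ψ : (c : W e) → InfFormula (m + arityOf c))
      (hlevel : ∀ c : W e, levelOf c < n + 1)
      (hindex : ∀ c : W e, HasIndex .sigma (levelOf c) (indexOf c) (ψ c)) :
      HasIndex .pi (n + 1) e (.allConj (W e) (fun c => arityOf c) ψ)

/-- `φ` is a computable `Σ_n` formula. -/
def IsComputableSigma (n : ℕ) {m : ℕ} (φ : InfFormula m) : Prop := ∃ e, HasIndex .sigma n e φ

/-- `φ` is a computable `Π_n` formula. -/
def IsComputablePi (n : ℕ) {m : ℕ} (φ : InfFormula m) : Prop := ∃ e, HasIndex .pi n e φ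

/-- `φ` is computable `d`-`Σ_n`: the conjunction of a computable `Σ_n` formula and a computable
`Π_n` formula. -/
def IsComputableDSigma (n : ℕ) {m : ℕ} (φ : InfFormula m) : Prop :=
  ∃ σ π : InfFormula m, IsComputableSigma n σ ∧ IsComputablePi n π ∧ φ = .and σ π

/-! ### Index sets -/

/-- The atomic diagram of a structure `B` whose universe is a set of natural numbers: the set of
(Gödel numbers of) atomic sentences and negated atomic sentences, with constants naming the
elements of `B`, that are true in `B`. -/
def atomicDiagram (B : Set ℕ) [groupLang.Structure B] : Set ℕ :=
  {c | ∃ s t : groupLang.Term B,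
    (c = eqCode (s.relabel Subtype.val) (t.relabel Subtype.val) ∧ s.realize id = t.realize id) ∨
    (c = neCode (s.relabel Subtype.val) (t.relabel Subtype.val) ∧ s.realize id ≠ t.realize id)}

open Classical in
/-- The characteristic function of a set of natural numbers. -/
noncomputable def charFun (D : Set ℕ) (n : ℕ) : ℕ := if n ∈ D then 1 else 0

/-- The index set `I(A)`: the set of all `e` such that `φ_e` is the characteristic function of the
atomic diagram of some `B ≅ A`, where the universe of `B` is a set of natural numbers. -/
def indexSet (A : Type*) [groupLang.Structure A] : Set ℕ :=
  {e | ∃ (B : Set ℕ) (_ : groupLang.Structure B), Nonempty (B ≃[groupLang] A) ∧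
    ∀ n, phi e n = Part.some (charFun (atomicDiagram B) n)}

/-! ### Complexity of sets of natural numbers -/

/-- `S` is `Σ⁰₂`. -/
def IsSigma02 (S : Set ℕ) : Prop :=
  ∃ R : ℕ × ℕ × ℕ → Prop, ComputablePred R ∧ ∀ n, n ∈ S ↔ ∃ x, ∀ y, R (n, x, y)

/-- `S` is `d`-`Σ⁰₂`: a difference of two `Σ⁰₂` sets. -/
def IsDSigma02 (S : Set ℕ) : Prop :=
  ∃ S₁ S₂ : Set ℕ, IsSigma02 S₁ ∧ IsSigma02 S₂ ∧ S = S₁ \ S₂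

/-- `I` is `m`-complete `d`-`Σ⁰₂`: it is `d`-`Σ⁰₂` and every `d`-`Σ⁰₂` set is many-one reducible
to it. -/
def IsMCompleteDSigma02 (I : Set ℕ) : Prop :=
  IsDSigma02 I ∧ ∀ S : Set ℕ, IsDSigma02 S → (fun n => n ∈ S) ≤₀ (fun e => e ∈ I)

end ScottDihedral

/-!
The proof rests on one description of the infinite dihedral group (`nonempty_equiv_dInfty_iff`). A
structure `M` is a copy of it if and only if

* `M` is a group with an involution `a` and an element `t` of infinite order without proper roots,
  such that `a t a = t⁻¹` (`HasPrimitiveRotation`), and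
* for all `a`, `t`, `x` with `a² = 1`, `a t a = t⁻¹` and `t² ≠ 1` there is a root `s` of `t` such
  that `x` is of the form `s ^ j` or `a s ^ j` with `j ∈ ℤ` (`HasCommonRotations`).

Indeed, for `a` and `t` as in the first item, the root `s` of `t` in the second can only be `t`
itself, so that `a` and `t` generate `M`. The first item is a computable `Σ₂` sentence with one
disjunct, and the second a computable `Π₂` sentence with one conjunct; their conjunction is the Scott
sentence.

For the index set, the universe `B` of a structure with atomic diagram `D` is the set of all `i`
such that the equation between the constant `i` and itself is in `D`. That a set `D` with a
computable characteristic function is an atomic diagram is a list of `∀∃` conditions on Gödel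
numbers (`DiagramClauses`), and the two items above translate into a `Π⁰₂` condition and the negation
of one (`RotationClauses`, `ImprimitiveClauses`). So the index set is `d`-`Σ⁰₂`.

For completeness, let `n ∈ S₁ ↔ ∃ x, ∀ y, ¬ F n x y` and `n ∈ S₂ ↔ ∃ x, ∀ y, ¬ G n x y`. Consider
the group of the isometries `y ↦ z / 2 ^ k ± y` of the rational line, for `z ∈ ℤ` and those `k` such
that each `x < k` is refuted by some `y` with `F n x y`. If `n ∈ S₁`, then there is a largest `k`, and
the group is infinite dihedral; otherwise all `k` are allowed, each rotation is a square, and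
`HasPrimitiveRotation` fails. The group has a copy whose atomic diagram is computable uniformly in
`n` (`codeSet`): a number codes an isometry together with a bound for the refutations needed, and the
universe consists of the least codes. To bring in `S₂`, the program for the diagram waits on input `c`
for some `y` with `G n c y`, so that it is total if and only if `n ∉ S₂`
(`manyOneReducible_indexSet`).
-/

namespace ScottDihedral

open FirstOrder

/-! ### A criterion for being a copy of the infinite dihedral group -/

section Operations

variable {M : Type*} [groupLang.Structure M]

/-- The identity of a structure for the language of groups, which need not be a group. -/
def gone : M := FirstOrder.Language.Structure.funMap (L := groupLang) GroupFunc.one ![]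

/-- The inverse in a structure for the language of groups. -/
def ginv (x : M) : M := FirstOrder.Language.Structure.funMap (L := groupLang) GroupFunc.inv ![x]

/-- The product in a structure for the language of groups. -/
def gmul (x y : M) : M :=
  FirstOrder.Language.Structure.funMap (L := groupLang) GroupFunc.mul ![x, y]

/-- The left-associated power `((1 * x) * x) * ⋯`. -/
def gpow (n : ℕ) (x : M) : M := n.rec gone fun _ y => gmul y x

variable {N : Type*} [groupLang.Structure N]

theorem map_gone (e : M ≃[groupLang] N) : e gone = gone := by
  simp only [gone, e.map_fun]
  congr 1
  exact Subsingleton.elim _ _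

theorem map_ginv (e : M ≃[groupLang] N) (x : M) : e (ginv x) = ginv (e x) := by
  simp only [ginv, e.map_fun]
  congr 1
  funext i
  fin_cases i
  rfl

theorem map_gmul (e : M ≃[groupLang] N) (x y : M) : e (gmul x y) = gmul (e x) (e y) := by
  simp only [gmul, e.map_fun]
  congr 1
  funext i
  fin_cases i <;> rfl

theorem map_gpow (e : M ≃[groupLang] N) (n : ℕ) (x : M) : e (gpow n x) = gpow n (e x) := by
  induction n with
  | zero => exact map_gone e
  | succ n ih => exact (map_gmul e _ _).trans (congrArg (gmul · (e x)) ih)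

variable (M)

/-- The `Σ₂` half of the description of the infinite dihedral group: the structure is a group, and
there are a reflection `a` and a rotation `t` of infinite order which has no proper root. -/
def HasPrimitiveRotation : Prop :=
  ∃ a t : M, ∀ (x y z : M) (n : ℕ),
    gmul (gmul x y) z = gmul x (gmul y z) ∧ gmul gone x = x ∧ gmul (ginv x) x = gone ∧
    gmul a a = gone ∧ gmul (gmul a t) a = ginv t ∧
    gpow (n + 1) t ≠ gone ∧ gpow (n + 2) x ≠ t

/-- The `Π₂` half of the description of the infinite dihedral group: if the involution `a` inverts
`t`, and `t² ≠ 1`, then for each `x` there is a root `s` of `t` such that `x` is of the form `s^j` or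
`a s^j` with `j ∈ ℤ`. -/
def HasCommonRotations : Prop :=
  ∀ a t x : M, gmul a a ≠ gone ∨ gmul (gmul a t) a ≠ ginv t ∨ gmul t t = gone ∨
    ∃ (s : M) (i j : ℕ), gpow i s = t ∧
      (x = gpow j s ∨ gmul x (gpow j s) = gone ∨ x = gmul a (gpow j s) ∨ gmul x (gpow j s) = a)

variable {M}

theorem HasPrimitiveRotation.of_equiv (e : M ≃[groupLang] N) (h : HasPrimitiveRotation N) :
    HasPrimitiveRotation M := by
  obtain ⟨a, t, h⟩ := h
  obtain ⟨a, rfl⟩ := e.surjective a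
  obtain ⟨t, rfl⟩ := e.surjective t
  refine ⟨a, t, fun x y z n => ?_⟩
  have := h (e x) (e y) (e z) n
  simpa only [← map_gone e, ← map_ginv, ← map_gmul, ← map_gpow, ne_eq, e.injective.eq_iff] using this

theorem HasCommonRotations.of_equiv (e : M ≃[groupLang] N) (h : HasCommonRotations N) :
    HasCommonRotations M := by
  intro a t x
  have := h (e a) (e t) (e x)
  rw [e.surjective.exists] at this
  simpa only [← map_gone e, ← map_ginv, ← map_gmul, ← map_gpow, ne_eq, e.injective.eq_iff] using this

end Operations

section Group

variable {G : Type*} [Group G]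

theorem gone_group : @gone G (groupStructure G) = 1 := rfl
theorem ginv_group (x : G) : @ginv G (groupStructure G) x = x⁻¹ := rfl
theorem gmul_group (x y : G) : @gmul G (groupStructure G) x y = x * y := rfl
theorem gpow_group (n : ℕ) (x : G) : @gpow G (groupStructure G) n x = x ^ n := by
  induction n with
  | zero => rw [pow_zero]; rfl
  | succ n ih => rw [pow_succ, ← ih]; rfl

/-- An isomorphism of groups, as an isomorphism of structures. -/
def mulEquivToEquiv {H : Type*} [Group H] (e : G ≃* H) :
    @FirstOrder.Language.Equiv groupLang G H (groupStructure G) (groupStructure H) :=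
  letI := groupStructure G
  letI := groupStructure H
  { e.toEquiv with
    map_fun' := fun {n} f x => by
      match n, f with
      | _, GroupFunc.one => exact e.map_one
      | _, GroupFunc.inv => exact e.map_inv _
      | _, GroupFunc.mul => exact e.map_mul _ _
    map_rel' := fun r _ => r.elim }

theorem zpow_mul_of_inverts {a t : G} (ha : a * a = 1) (hat : a * t * a = t⁻¹) (i : ℤ) :
    t ^ i * a = a * t ^ (-i) := by
  have ha' : a⁻¹ = a := inv_eq_of_mul_eq_one_left ha
  have h : a * t ^ i * a⁻¹ = t ^ (-i) := by
    rw [← conj_zpow, ha', hat, inv_zpow, zpow_neg]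
  rw [← h, ha', ← mul_assoc, ← mul_assoc, ha, one_mul]

/-- A group generated by a rotation `t` of infinite order and a reflection `a` which inverts it is
the infinite dihedral group. -/
theorem nonempty_mulEquiv_dihedralGroup {a t : G} (ha : a * a = 1) (hat : a * t * a = t⁻¹)
    (ht : ∀ n : ℕ, t ^ (n + 1) ≠ 1) (h : ∀ x : G, ∃ i : ℤ, x = t ^ i ∨ x = a * t ^ i) :
    Nonempty (DihedralGroup 0 ≃* G) := by
  have hinj : Function.Injective fun i : ℤ => t ^ i := by
    rw [injective_zpow_iff_not_isOfFinOrder, isOfFinOrder_iff_pow_eq_one]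
    rintro ⟨n, hn, h1⟩
    obtain ⟨m, rfl⟩ := Nat.exists_eq_succ_of_ne_zero hn.ne'
    exact ht m h1
  -- `a` does not commute with `t`, because `t² ≠ 1`
  have hna : ∀ i : ℤ, a ≠ t ^ i := by
    rintro i rfl
    have h1 : t * t = 1 := by
      rw [((Commute.refl t).zpow_left i).eq, mul_assoc, ha, mul_one] at hat
      exact mul_eq_one_iff_eq_inv.2 hat
    exact ht 1 (by rw [pow_two, h1])
  let F : DihedralGroup 0 → G := fun g => match g with
    | .r i => t ^ (show ℤ from i)
    | .sr i => a * t ^ (show ℤ from i)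
  refine ⟨MulEquiv.ofBijective (MonoidHom.mk' F ?_) ⟨?_, ?_⟩⟩
  · rintro (i | i) (j | j)
    · exact zpow_add t _ _
    · change a * t ^ ((show ℤ from j) - (show ℤ from i)) = t ^ (show ℤ from i) * (a * t ^ (show ℤ from j))
      rw [← mul_assoc, zpow_mul_of_inverts ha hat, mul_assoc, ← zpow_add]
      congr 2; ring
    · change a * t ^ ((show ℤ from i) + (show ℤ from j)) = _
      rw [zpow_add, ← mul_assoc]
    · change t ^ ((show ℤ from j) - (show ℤ from i)) = a * t ^ (show ℤ from i) * (a * t ^ (show ℤ from j))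
      rw [mul_assoc, ← mul_assoc _ a, zpow_mul_of_inverts ha hat, mul_assoc, ← mul_assoc, ha,
        one_mul, ← zpow_add]
      congr 1; ring
  · rintro (i | i) (j | j) hij
    · exact congrArg DihedralGroup.r (hinj hij)
    · exact (hna ((show ℤ from i) - (show ℤ from j))
        (by rw [zpow_sub]; exact eq_mul_inv_of_mul_eq hij.symm)).elim
    · exact (hna ((show ℤ from j) - (show ℤ from i))
        (by rw [zpow_sub]; exact eq_mul_inv_of_mul_eq hij)).elim
    · exact congrArg DihedralGroup.sr (hinj (mul_left_cancel hij))
  · intro x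
    obtain ⟨i, h | h⟩ := h x
    · exact ⟨.r i, h.symm⟩
    · exact ⟨.sr i, h.symm⟩

end Group

/-- With `t = a b`, the group `⟨a, b ∣ a² = b² = 1⟩` is generated by `t` and `a`, and `a t a = t⁻¹`.
That `t` has infinite order is seen in the dihedral group of the integers. -/
theorem nonempty_dihedralGroup_mulEquiv_dInfty : Nonempty (DihedralGroup 0 ≃* DInfty) := by
  let a : DInfty := PresentedGroup.of 0
  let b : DInfty := PresentedGroup.of 1
  have ha : a * a = 1 := by
    have := PresentedGroup.one_of_mem
      (rels := ({FreeGroup.of 0 ^ 2, FreeGroup.of 1 ^ 2} : Set (FreeGroup (Fin 2))))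
      (x := FreeGroup.of 0 ^ 2) (by simp)
    rwa [map_pow, pow_two] at this
  have hb : b * b = 1 := by
    have := PresentedGroup.one_of_mem
      (rels := ({FreeGroup.of 0 ^ 2, FreeGroup.of 1 ^ 2} : Set (FreeGroup (Fin 2))))
      (x := FreeGroup.of 1 ^ 2) (by simp)
    rwa [map_pow, pow_two] at this
  have ha' : a⁻¹ = a := inv_eq_of_mul_eq_one_left ha
  have hb' : b⁻¹ = b := inv_eq_of_mul_eq_one_left hb
  have hat : a * (a * b) * a = (a * b)⁻¹ := by
    rw [mul_inv_rev, ha', hb', ← mul_assoc, ha, one_mul]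
  refine nonempty_mulEquiv_dihedralGroup (a := a) (t := a * b) ha hat ?_ ?_
  · -- `a` and `b` act on the integers as reflections whose product is the translation by `1`
    intro n hn
    let f : Fin 2 → DihedralGroup 0 := ![.sr 0, .sr 1]
    have hf : ∀ r ∈ ({FreeGroup.of 0 ^ 2, FreeGroup.of 1 ^ 2} : Set (FreeGroup (Fin 2))),
        FreeGroup.lift f r = 1 := by
      rintro r (rfl | rfl) <;> simp [f, pow_two]
    have h1 := congrArg (PresentedGroup.toGroup hf) hn
    rw [map_pow, map_mul, PresentedGroup.toGroup.of, PresentedGroup.toGroup.of, map_one] at h1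
    simp only [f, Matrix.cons_val_zero, Matrix.cons_val_one, DihedralGroup.sr_mul_sr, sub_zero,
      DihedralGroup.r_one_pow, DihedralGroup.one_def, DihedralGroup.r.injEq] at h1
    exact Nat.succ_ne_zero n (by exact_mod_cast (show ((n + 1 : ℕ) : ℤ) = 0 from h1))
  · -- the elements `tⁱ` and `a tⁱ` are permuted by multiplication with a generator
    have hmul : ∀ c x : DInfty, (c = a ∨ c = b) →
        (∃ i : ℤ, x = (a * b) ^ i ∨ x = a * (a * b) ^ i) →
        ∃ i : ℤ, c * x = (a * b) ^ i ∨ c * x = a * (a * b) ^ i := by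
      have hb2 : b = a * (a * b) := by rw [← mul_assoc, ha, one_mul]
      have hba : b * a = (a * b) ^ (-1 : ℤ) := by
        rw [zpow_neg_one, mul_inv_rev, ha', hb']
      rintro c x (rfl | rfl) ⟨i, rfl | rfl⟩
      · exact ⟨i, Or.inr rfl⟩
      · exact ⟨i, Or.inl (by rw [← mul_assoc, ha, one_mul])⟩
      · refine ⟨1 + i, Or.inr ?_⟩
        rw [zpow_one_add, ← mul_assoc a (a * b), ← hb2]
      · refine ⟨-1 + i, Or.inl ?_⟩
        rw [← mul_assoc, hba, ← zpow_add]
    intro x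
    induction x using PresentedGroup.induction_on with
    | _ w =>
      have hof : ∀ i : Fin 2, PresentedGroup.mk
          ({FreeGroup.of 0 ^ 2, FreeGroup.of 1 ^ 2} : Set (FreeGroup (Fin 2))) (FreeGroup.of i) = a ∨
          PresentedGroup.mk
          ({FreeGroup.of 0 ^ 2, FreeGroup.of 1 ^ 2} : Set (FreeGroup (Fin 2))) (FreeGroup.of i) = b := by
        intro i
        fin_cases i
        · exact Or.inl rfl
        · exact Or.inr rfl
      suffices H : ∀ (w : FreeGroup (Fin 2)) (y : DInfty),
          (∃ i : ℤ, y = (a * b) ^ i ∨ y = a * (a * b) ^ i) →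
          ∃ i : ℤ, PresentedGroup.mk _ w * y = (a * b) ^ i ∨
            PresentedGroup.mk _ w * y = a * (a * b) ^ i by
        simpa using H w 1 ⟨0, by simp⟩
      intro w
      induction w using FreeGroup.induction_on with
      | C1 => intro y hy; simpa using hy
      | of i => exact fun y hy => hmul _ _ (hof i) hy
      | inv_of i _ =>
        intro y hy
        have h2 := hof i
        rw [← inv_inj, ← inv_inj (b := b), ha', hb'] at h2
        rw [map_inv]
        exact hmul _ _ h2 hy
      | mul u w hu hw =>
        intro y hy
        rw [map_mul, mul_assoc]
        exact hu _ (hw _ hy)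

theorem hasPrimitiveRotation_dihedralGroup :
    @HasPrimitiveRotation (DihedralGroup 0) (groupStructure _) := by
  let _ := groupStructure (DihedralGroup 0)
  -- the witnesses are a reflection and the generator of the rotations
  refine ⟨.sr 0, .r 1, fun x y z n => ?_⟩
  simp only [gone_group, ginv_group, gmul_group, gpow_group, mul_assoc, one_mul, inv_mul_cancel,
    true_and]
  refine ⟨by simp, by simp, fun h => ?_, fun h => ?_⟩
  · simp only [DihedralGroup.r_one_pow, DihedralGroup.one_def, DihedralGroup.r.injEq] at h
    exact Nat.succ_ne_zero n (by exact_mod_cast (show ((n + 1 : ℕ) : ℤ) = 0 from h))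
  · rcases x with k | k
    · simp only [DihedralGroup.r_pow, DihedralGroup.r.injEq] at h
      have h1 : (show ℤ from k) * ((n + 2 : ℕ) : ℤ) = 1 := h
      have h2 := Int.isUnit_iff.1 (IsUnit.of_mul_eq_one _ ((mul_comm _ _).trans h1))
      push_cast at h2
      omega
    · -- a power of a reflection has order at most two
      have h1 : (DihedralGroup.sr k : DihedralGroup 0) ^ (n + 2) *
          (DihedralGroup.sr k : DihedralGroup 0) ^ (n + 2) = 1 := by
        rw [← (Commute.refl _).mul_pow, DihedralGroup.sr_mul_self, one_pow]
      rw [h, DihedralGroup.r_mul_r, DihedralGroup.one_def, DihedralGroup.r.injEq] at h1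
      exact absurd (show (1 : ℤ) + 1 = 0 from h1) (by norm_num)

theorem hasCommonRotations_dihedralGroup :
    @HasCommonRotations (DihedralGroup 0) (groupStructure _) := by
  let _ := groupStructure (DihedralGroup 0)
  intro a t x
  simp only [gone_group, ginv_group, gmul_group, gpow_group]
  rcases t with k | k
  swap
  · exact Or.inr (Or.inr (Or.inl (DihedralGroup.sr_mul_self k)))
  rcases a with l | l
  · by_cases h : (DihedralGroup.r l * DihedralGroup.r k * DihedralGroup.r l : DihedralGroup 0) =
      (DihedralGroup.r k)⁻¹
    · by_cases h' : (DihedralGroup.r l * DihedralGroup.r l : DihedralGroup 0) = 1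
      · refine Or.inr (Or.inr (Or.inl ?_))
        simp only [DihedralGroup.r_mul_r, DihedralGroup.one_def, DihedralGroup.r.injEq,
          DihedralGroup.inv_r] at h h' ⊢
        linear_combination h - h'
      · exact Or.inl h'
    · exact Or.inr (Or.inl h)
  refine Or.inr (Or.inr (Or.inr ?_))
  -- the root is the generator of the rotations which has `t` among its nonnegative powers
  obtain ⟨u, i, hu, hi⟩ : ∃ (u : ℤ) (i : ℕ), u * u = 1 ∧ (show ℤ from k) = u * i := by
    rcases Int.natAbs_eq (show ℤ from k) with h | h
    · exact ⟨1, _, rfl, by rw [one_mul]; exact h⟩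
    · exact ⟨-1, _, rfl, by rw [neg_one_mul]; exact h⟩
  have key : ∀ c : ℤ, ∃ j : ℕ, c = u * j ∨ c + u * j = 0 := by
    intro c
    rcases Int.natAbs_eq (c * u) with h | h
    · exact ⟨(c * u).natAbs, Or.inl (by rw [← h]; linear_combination (-c) * hu)⟩
    · refine ⟨(c * u).natAbs, Or.inr ?_⟩
      have : ((c * u).natAbs : ℤ) = -(c * u) := by omega
      rw [this]; linear_combination (-c) * hu
  have hpow : ∀ j : ℕ, (DihedralGroup.r (show ZMod 0 from u) : DihedralGroup 0) ^ j =
      DihedralGroup.r (show ZMod 0 from (u * j : ℤ)) := fun j => DihedralGroup.r_pow _ _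
  rcases x with c | c
  · obtain ⟨j, hj | hj⟩ := key (show ℤ from c)
    · refine ⟨.r u, i, j, ?_, Or.inl ?_⟩ <;> rw [hpow]
      · exact congrArg _ hi.symm
      · exact congrArg _ hj
    · refine ⟨.r u, i, j, ?_, Or.inr (Or.inl ?_)⟩ <;> rw [hpow]
      · exact congrArg _ hi.symm
      · rw [DihedralGroup.r_mul_r]; exact congrArg _ hj
  · obtain ⟨j, hj | hj⟩ := key ((show ℤ from c) - (show ℤ from l))
    · refine ⟨.r u, i, j, ?_, Or.inr (Or.inr (Or.inl ?_))⟩ <;> rw [hpow]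
      · exact congrArg _ hi.symm
      · rw [DihedralGroup.sr_mul_r]
        exact congrArg DihedralGroup.sr (eq_add_of_sub_eq' hj)
    · refine ⟨.r u, i, j, ?_, Or.inr (Or.inr (Or.inr ?_))⟩ <;> rw [hpow]
      · exact congrArg _ hi.symm
      · rw [DihedralGroup.sr_mul_r]
        refine congrArg DihedralGroup.sr (show (show ℤ from c) + u * j = (show ℤ from l) from ?_)
        linear_combination hj

/-- The two halves of the description characterize the infinite dihedral group up to isomorphism:
the root of the primitive rotation `t` which the second half provides can only be `t`. -/
theorem nonempty_equiv_dInfty_iff {M : Type*} [inst : groupLang.Structure M] :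
    Nonempty (M ≃[groupLang] DInfty) ↔ HasPrimitiveRotation M ∧ HasCommonRotations M := by
  obtain ⟨d⟩ := nonempty_dihedralGroup_mulEquiv_dInfty
  constructor
  · rintro ⟨e⟩
    let e' := (@FirstOrder.Language.Equiv.comp groupLang M DInfty inst _ (DihedralGroup 0)
      (groupStructure _) (mulEquivToEquiv d.symm) e)
    exact ⟨@HasPrimitiveRotation.of_equiv M inst _ (groupStructure _) e'
      hasPrimitiveRotation_dihedralGroup, @HasCommonRotations.of_equiv M inst _ (groupStructure _) e'
      hasCommonRotations_dihedralGroup⟩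
  · rintro ⟨⟨a, t, h⟩, h2⟩
    let _ : Mul M := ⟨gmul⟩
    let _ : One M := ⟨gone⟩
    let _ : Inv M := ⟨ginv⟩
    let _ : Group M := Group.ofLeftAxioms (fun x y z => (h x y z 0).1)
      (fun x => (h x x x 0).2.1) (fun x => (h x x x 0).2.2.1)
    -- the group operations read off from the structure give the structure back
    have hinst : inst = groupStructure M := by
      ext n f x
      · match n, f with
        | _, GroupFunc.one => exact congrArg _ (Subsingleton.elim _ _)
        | _, GroupFunc.inv =>
          refine congrArg (inst.funMap GroupFunc.inv) (funext fun i => ?_)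
          fin_cases i
          rfl
        | _, GroupFunc.mul =>
          refine congrArg (inst.funMap GroupFunc.mul) (funext fun i => ?_)
          fin_cases i <;> rfl
      · exact f.elim
    have hone : (gone : M) = 1 := rfl
    have hinv : ∀ x : M, ginv x = x⁻¹ := fun _ => rfl
    have hmul : ∀ x y : M, gmul x y = x * y := fun _ _ => rfl
    have hpow : ∀ n (x : M), gpow n x = x ^ n := fun n x => by
      rw [← gpow_group]; congr 1
    simp only [HasCommonRotations, hone, hinv, hmul, hpow] at h h2
    obtain ⟨-, -, -, ha, hat, -, -⟩ := h 1 1 1 0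
    have ht : ∀ n, t ^ (n + 1) ≠ 1 := fun n => (h 1 1 1 n).2.2.2.2.2.1
    have hprim : ∀ n x, x ^ (n + 2) ≠ t := fun n x => (h x 1 1 n).2.2.2.2.2.2
    obtain ⟨g⟩ := nonempty_mulEquiv_dihedralGroup ha hat ht (fun x => by
      obtain h3 | h3 | h3 | ⟨s, i, j, hs, hx⟩ := h2 a t x
      · exact (h3 ha).elim
      · exact (h3 hat).elim
      · exact (ht 1 (by rw [pow_two, h3])).elim
      -- `t` is neither trivial nor a proper power
      obtain rfl : t = s := by
        match i, hs with
        | 0, hs => exact (ht 0 (by rw [zero_add, pow_one, ← hs, pow_zero])).elim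
        | 1, hs => rw [← hs, pow_one]
        | i + 2, hs => exact (hprim i s hs).elim
      obtain hx | hx | hx | hx := hx
      · exact ⟨j, Or.inl (by rw [hx, zpow_natCast])⟩
      · exact ⟨-j, Or.inl (by rw [zpow_neg, zpow_natCast]; exact eq_inv_of_mul_eq_one_left hx)⟩
      · exact ⟨j, Or.inr (by rw [hx, zpow_natCast])⟩
      · exact ⟨-j, Or.inr (by rw [zpow_neg, zpow_natCast]; exact eq_mul_inv_of_mul_eq hx)⟩)
    have := mulEquivToEquiv (g.symm.trans d)
    rw [← hinst] at this
    exact ⟨this⟩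

/-! ### Recursively enumerable predicates -/

section RE

variable {α β : Type*} [Primcodable α] [Primcodable β]

theorem rePred_of_computablePred {R : α → ℕ → Prop}
    (hR : ComputablePred fun x : α × ℕ => R x.1 x.2) : REPred fun a => ∃ k, R a k := by
  classical
  refine (Partrec.dom_re (Partrec.rfind (p := fun a k => Part.some (decide (R a k)))
    hR.decide.partrec)).of_eq fun a => ?_
  refine Nat.rfind_dom.trans (exists_congr fun k => ?_)
  rw [Part.mem_some_iff, eq_comm, decide_eq_true_iff]
  exact and_iff_left fun _ => trivial

/-- Normal form: an r.e. predicate is the projection of a primitive recursive one, which says that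
the program halts in `k` steps. -/
theorem _root_.REPred.exists_primrecPred {p : α → Prop} (hp : REPred p) :
    ∃ R : α → ℕ → Prop, (PrimrecPred fun x : α × ℕ => R x.1 x.2) ∧ ∀ a, p a ↔ ∃ k, R a k := by
  obtain ⟨c, hc⟩ := Nat.Partrec.Code.exists_code.1 hp
  refine ⟨fun a k => (Nat.Partrec.Code.evaln k c (Encodable.encode a)).isSome = true, ?_, fun a => ?_⟩
  · have h1 : Primrec fun x : α × ℕ => Nat.Partrec.Code.evaln x.2 c (Encodable.encode x.1) :=
      Nat.Partrec.Code.primrec_evaln.comp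
        ((Primrec.snd.pair (Primrec.const c)).pair (Primrec.encode.comp Primrec.fst))
    exact (Primrec.primrecPred ((Primrec.option_isSome.comp h1).of_eq fun x => by simp))
  · have h1 : p a ↔ (c.eval (Encodable.encode a)).Dom := by
      rw [hc]; simp [Part.bind, Part.assert, Part.map]
    rw [h1, Part.dom_iff_mem]
    simp only [Nat.Partrec.Code.evaln_complete, Option.isSome_iff_exists, Option.mem_def]
    exact exists_comm

theorem _root_.REPred.comp {p : β → Prop} (hp : REPred p) {f : α → β} (hf : Computable f) :
    REPred fun a => p (f a) := Partrec.comp hp hf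

theorem _root_.REPred.and {p q : α → Prop} (hp : REPred p) (hq : REPred q) :
    REPred fun a => p a ∧ q a := by
  obtain ⟨R, hR, h⟩ := hp.exists_primrecPred
  obtain ⟨S, hS, h'⟩ := hq.exists_primrecPred
  refine (rePred_of_computablePred (R := fun a k => R a k.unpair.1 ∧ S a k.unpair.2)
    (PrimrecPred.computablePred ?_)).of_eq fun a => ?_
  · exact (hR.comp (Primrec.fst.pair (Primrec.fst.comp (Primrec.unpair.comp Primrec.snd)))).and
      (hS.comp (Primrec.fst.pair (Primrec.snd.comp (Primrec.unpair.comp Primrec.snd))))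
  · rw [h, h']
    constructor
    · rintro ⟨k, h1, h2⟩; exact ⟨⟨_, h1⟩, ⟨_, h2⟩⟩
    · rintro ⟨⟨k, h1⟩, ⟨l, h2⟩⟩; exact ⟨Nat.pair k l, by simpa using ⟨h1, h2⟩⟩

theorem _root_.REPred.or {p q : α → Prop} (hp : REPred p) (hq : REPred q) :
    REPred fun a => p a ∨ q a := by
  obtain ⟨R, hR, h⟩ := hp.exists_primrecPred
  obtain ⟨S, hS, h'⟩ := hq.exists_primrecPred
  exact (rePred_of_computablePred (R := fun a k => R a k ∨ S a k)
    (hR.or hS).computablePred).of_eq fun a => by rw [h, h', exists_or]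

theorem _root_.REPred.exists_snd {p : α → ℕ → Prop} (hp : REPred fun x : α × ℕ => p x.1 x.2) :
    REPred fun a => ∃ n, p a n := by
  obtain ⟨R, hR, h⟩ := hp.exists_primrecPred
  refine (rePred_of_computablePred (R := fun a k => R (a, k.unpair.1) k.unpair.2)
    (PrimrecPred.computablePred ?_)).of_eq fun a => ?_
  · have h1 := Primrec.unpair.comp (Primrec.snd (α := α) (β := ℕ))
    exact hR.comp ((Primrec.fst.pair (Primrec.fst.comp h1)).pair (Primrec.snd.comp h1))
  · constructor
    · rintro ⟨k, h1⟩; exact ⟨_, (h (a, _)).2 ⟨_, h1⟩⟩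
    · rintro ⟨n, h1⟩
      obtain ⟨k, h2⟩ := (h (a, n)).1 h1
      exact ⟨Nat.pair n k, by simpa using h2⟩

theorem exists_W_eq {p : ℕ → Prop} (hp : REPred p) : ∃ e, W e = {c | p c} := by
  have h1 : Partrec fun c : ℕ => (Part.assert (p c) fun _ => Part.some ()).map fun _ => 0 :=
    Partrec.map hp (Computable.const 0).to₂
  obtain ⟨c, hc⟩ := Nat.Partrec.Code.exists_code.1 (Partrec.nat_iff.1 h1)
  refine ⟨Encodable.encode c, Set.ext fun n => ?_⟩
  simp [W, phi, hc, Part.map, Part.assert]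

end RE

/-! ### A computable `d`-`Σ₂` Scott sentence -/

section Terms

variable {α : Type*}

/-- The term for the identity. -/
def tone : groupLang.Term α := .func GroupFunc.one ![]

/-- The term for an inverse. -/
def tinv (s : groupLang.Term α) : groupLang.Term α := .func GroupFunc.inv ![s]

/-- The term for a product. -/
def tmul (s t : groupLang.Term α) : groupLang.Term α := .func GroupFunc.mul ![s, t]

/-- The term for the left-associated power. -/
def tpow (n : ℕ) (s : groupLang.Term α) : groupLang.Term α := n.rec tone fun _ r => tmul r s

section Realize

variable {M : Type*} [groupLang.Structure M] (v : α → M)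

@[simp] theorem realize_tone : (tone : groupLang.Term α).realize v = gone :=
  congrArg (FirstOrder.Language.Structure.funMap (L := groupLang) GroupFunc.one) (Subsingleton.elim _ _)

@[simp] theorem realize_tinv (s : groupLang.Term α) : (tinv s).realize v = ginv (s.realize v) := by
  refine congrArg (FirstOrder.Language.Structure.funMap (L := groupLang) GroupFunc.inv) (funext fun i => ?_)
  fin_cases i
  rfl

@[simp] theorem realize_tmul (s t : groupLang.Term α) :
    (tmul s t).realize v = gmul (s.realize v) (t.realize v) := by
  refine congrArg (FirstOrder.Language.Structure.funMap (L := groupLang) GroupFunc.mul) (funext fun i => ?_)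
  fin_cases i <;> rfl

@[simp] theorem realize_tpow (n : ℕ) (s : groupLang.Term α) :
    (tpow n s).realize v = gpow n (s.realize v) := by
  induction n with
  | zero => exact realize_tone v
  | succ n ih => exact (realize_tmul v _ _).trans (congrArg (gmul · _) ih)

end Realize

section Relabel

variable {β : Type*} (f : α → β)

@[simp] theorem relabel_tone : (tone : groupLang.Term α).relabel f = tone :=
  congrArg (FirstOrder.Language.Term.func (L := groupLang) GroupFunc.one) (Subsingleton.elim _ _)

@[simp] theorem relabel_tinv (s : groupLang.Term α) : (tinv s).relabel f = tinv (s.relabel f) := by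
  refine congrArg (FirstOrder.Language.Term.func (L := groupLang) GroupFunc.inv) (funext fun i => ?_)
  fin_cases i
  rfl

@[simp] theorem relabel_tmul (s t : groupLang.Term α) :
    (tmul s t).relabel f = tmul (s.relabel f) (t.relabel f) := by
  refine congrArg (FirstOrder.Language.Term.func (L := groupLang) GroupFunc.mul) (funext fun i => ?_)
  fin_cases i <;> rfl

@[simp] theorem relabel_tpow (n : ℕ) (s : groupLang.Term α) :
    (tpow n s).relabel f = tpow n (s.relabel f) := by
  induction n with
  | zero => exact relabel_tone f
  | succ n ih => exact (relabel_tmul f _ _).trans (congrArg (tmul · _) ih)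

end Relabel

/-- The Gödel number of a power, as a function of the Gödel number of its base. -/
def powCode (n c : ℕ) : ℕ := n.rec (Nat.pair 1 0) fun _ r => Nat.pair 3 (Nat.pair r c)

theorem termCode_tone : termCode tone = Nat.pair 1 0 := by simp [tone, termCode]

theorem termCode_tinv (s : groupLang.Term ℕ) : termCode (tinv s) = Nat.pair 2 (termCode s) := by
  simp [tinv, termCode]

theorem termCode_tmul (s t : groupLang.Term ℕ) :
    termCode (tmul s t) = Nat.pair 3 (Nat.pair (termCode s) (termCode t)) := by
  simp [tmul, termCode]

theorem termCode_tpow (n : ℕ) (s : groupLang.Term ℕ) :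
    termCode (tpow n s) = powCode n (termCode s) := by
  induction n with
  | zero => exact termCode_tone
  | succ n ih =>
    exact (termCode_tmul _ _).trans (congrArg (fun r => Nat.pair 3 (Nat.pair r (termCode s))) ih)

theorem primrec_powCode : Primrec₂ powCode := by
  have h : Primrec₂ fun (c : ℕ) (x : ℕ × ℕ) => Nat.pair 3 (Nat.pair x.2 c) :=
    Primrec₂.natPair.comp (Primrec.const 3)
      (Primrec₂.natPair.comp (Primrec.snd.comp Primrec.snd) Primrec.fst)
  exact (Primrec.nat_rec (Primrec.const (Nat.pair 1 0)) h).swap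

end Terms

/-- A function of `n` whose values are terms with a primitive recursive Gödel number. -/
def PrimrecTerm {m : ℕ} (s : ℕ → groupLang.Term (Fin m)) : Prop :=
  Primrec fun n => termCode ((s n).relabel Fin.val)

/-- A function of `n` whose values are quantifier-free formulas with a primitive recursive Gödel
number. -/
def PrimrecQF {m : ℕ} (φ : ℕ → QF m) : Prop := Primrec fun n => (φ n).code

section PrimrecQF

variable {m : ℕ}

theorem PrimrecTerm.const (s : groupLang.Term (Fin m)) : PrimrecTerm fun _ => s := Primrec.const _

theorem PrimrecTerm.mul {s t : ℕ → groupLang.Term (Fin m)} (hs : PrimrecTerm s)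
    (ht : PrimrecTerm t) : PrimrecTerm fun n => tmul (s n) (t n) :=
  (Primrec₂.natPair.comp (Primrec.const 3) (Primrec₂.natPair.comp hs ht)).of_eq fun n => by
    rw [relabel_tmul, termCode_tmul]

theorem PrimrecTerm.pow {f : ℕ → ℕ} (hf : Primrec f) (s : groupLang.Term (Fin m)) :
    PrimrecTerm fun n => tpow (f n) s :=
  (primrec_powCode.comp hf (Primrec.const _)).of_eq fun n => by
    rw [relabel_tpow, termCode_tpow]

theorem PrimrecQF.const (φ : QF m) : PrimrecQF fun _ => φ := Primrec.const _

theorem PrimrecQF.eq {s t : ℕ → groupLang.Term (Fin m)} (hs : PrimrecTerm s) (ht : PrimrecTerm t) :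
    PrimrecQF fun n => .eq (s n) (t n) :=
  Primrec₂.natPair.comp (Primrec.const 0) (Primrec₂.natPair.comp hs ht)

theorem PrimrecQF.ne {s t : ℕ → groupLang.Term (Fin m)} (hs : PrimrecTerm s) (ht : PrimrecTerm t) :
    PrimrecQF fun n => .ne (s n) (t n) :=
  Primrec₂.natPair.comp (Primrec.const 1) (Primrec₂.natPair.comp hs ht)

theorem PrimrecQF.and {φ ψ : ℕ → QF m} (hφ : PrimrecQF φ) (hψ : PrimrecQF ψ) :
    PrimrecQF fun n => .and (φ n) (ψ n) :=
  Primrec₂.natPair.comp (Primrec.const 2) (Primrec₂.natPair.comp hφ hψ)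

theorem PrimrecQF.or {φ ψ : ℕ → QF m} (hφ : PrimrecQF φ) (hψ : PrimrecQF ψ) :
    PrimrecQF fun n => .or (φ n) (ψ n) :=
  Primrec₂.natPair.comp (Primrec.const 3) (Primrec₂.natPair.comp hφ hψ)

end PrimrecQF

/-- The set `{⟨b, ⟨k, i n⟩⟩}` is c.e., and each of its elements indexes the formula `χ n` it comes
from, which by `inj` depends on that element only. -/
theorem exists_W_formulas {s : Side} {m k b : ℕ} {χ : ℕ → InfFormula (m + k)} {i : ℕ → ℕ}
    (hi : Computable i) (hχ : ∀ n, HasIndex s b (i n) (χ n))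
    (inj : ∀ n n', i n = i n' → χ n = χ n') :
    ∃ (e : ℕ) (ψ : (c : W e) → InfFormula (m + arityOf c)),
      (∀ c : W e, levelOf c = b) ∧ (∀ c : W e, HasIndex s (levelOf c) (indexOf c) (ψ c)) ∧
      ∀ (M : Type u) [groupLang.Structure M] (v : Fin m → M),
        ((∃ c, ∃ y, (ψ c).Sat M (Fin.append v y)) ↔ ∃ n, ∃ y, (χ n).Sat M (Fin.append v y)) ∧
        ((∀ c, ∀ y, (ψ c).Sat M (Fin.append v y)) ↔ ∀ n, ∀ y, (χ n).Sat M (Fin.append v y)) := by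
  have hre : REPred fun c => ∃ n, c = Nat.pair b (Nat.pair k (i n)) := by
    refine rePred_of_computablePred ?_
    have h1 : Computable fun x : ℕ × ℕ => Nat.pair b (Nat.pair k (i x.2)) :=
      Primrec₂.natPair.to_comp.comp (Computable.const b)
        (Primrec₂.natPair.to_comp.comp (Computable.const k) (hi.comp Computable.snd))
    exact Computable.computablePred
      ((Primrec.eq (α := ℕ)).decide.to_comp.comp Computable.fst h1)
  obtain ⟨e, he⟩ := exists_W_eq hre
  have hmem : ∀ n, Nat.pair b (Nat.pair k (i n)) ∈ W e := fun n => by rw [he]; exact ⟨n, rfl⟩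
  have haux : ∀ b' k' i' n, b' = b → k' = k → i' = i n → ∃ ψ : InfFormula (m + k'),
      HasIndex s b' i' ψ ∧ ∀ n', i n' = i' → ∀ (M : Type u) [groupLang.Structure M] (v : Fin m → M),
        ((∃ y, ψ.Sat M (Fin.append v y)) ↔ ∃ y, (χ n').Sat M (Fin.append v y)) ∧
        ((∀ y, ψ.Sat M (Fin.append v y)) ↔ ∀ y, (χ n').Sat M (Fin.append v y)) := by
    rintro b' k' i' n rfl rfl rfl
    refine ⟨χ n, hχ n, fun n' h M _ v => ?_⟩
    rw [inj n' n h]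
    exact ⟨Iff.rfl, Iff.rfl⟩
  have hW : ∀ c : W e, ∃ n, (c : ℕ) = Nat.pair b (Nat.pair k (i n)) := fun c =>
    he.subset c.2
  have hex : ∀ c : W e, ∃ ψ : InfFormula (m + arityOf c),
      HasIndex s (levelOf c) (indexOf c) ψ ∧ ∀ n', i n' = indexOf c →
        ∀ (M : Type u) [groupLang.Structure M] (v : Fin m → M),
        ((∃ y, ψ.Sat M (Fin.append v y)) ↔ ∃ y, (χ n').Sat M (Fin.append v y)) ∧
        ((∀ y, ψ.Sat M (Fin.append v y)) ↔ ∀ y, (χ n').Sat M (Fin.append v y)) := by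
    intro c
    obtain ⟨n, hn⟩ := hW c
    exact haux _ _ _ n (by simp [levelOf, hn]) (by simp [arityOf, hn]) (by simp [indexOf, hn])
  choose ψ hψ hsat using hex
  refine ⟨e, ψ, fun c => ?_, hψ, fun M _ v => ⟨⟨?_, ?_⟩, ⟨?_, ?_⟩⟩⟩
  · obtain ⟨n, hn⟩ := hW c
    simp [levelOf, hn]
  · rintro ⟨c, h⟩
    obtain ⟨n, hn⟩ := hW c
    exact ⟨n, ((hsat c n (by simp [indexOf, hn]) M v).1).1 h⟩
  · rintro ⟨n, h⟩
    exact ⟨⟨_, hmem n⟩, ((hsat ⟨_, hmem n⟩ n (by simp [indexOf]) M v).1).2 h⟩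
  · intro h n
    exact ((hsat ⟨_, hmem n⟩ n (by simp [indexOf]) M v).2).1 (h ⟨_, hmem n⟩)
  · intro h c
    obtain ⟨n, hn⟩ := hW c
    exact ((hsat c n (by simp [indexOf, hn]) M v).2).2 (h n)

theorem exists_isComputableSigma {m k b N : ℕ} {χ : ℕ → InfFormula (m + k)} {i : ℕ → ℕ}
    (hi : Computable i) (hχ : ∀ n, HasIndex .pi b (i n) (χ n))
    (inj : ∀ n n', i n = i n' → χ n = χ n') (hb : b < N + 1) :
    ∃ φ : InfFormula m, IsComputableSigma (N + 1) φ ∧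
      ∀ (M : Type u) [groupLang.Structure M] (v : Fin m → M),
        φ.Sat M v ↔ ∃ n, ∃ y, (χ n).Sat M (Fin.append v y) := by
  obtain ⟨e, ψ, hlevel, hindex, hsat⟩ := exists_W_formulas hi hχ inj
  exact ⟨_, ⟨e, .exDisj N e ψ (fun c => (hlevel c).trans_lt hb) hindex⟩,
    fun M _ v => (hsat M v).1⟩

theorem exists_isComputablePi {m k b N : ℕ} {χ : ℕ → InfFormula (m + k)} {i : ℕ → ℕ}
    (hi : Computable i) (hχ : ∀ n, HasIndex .sigma b (i n) (χ n))
    (inj : ∀ n n', i n = i n' → χ n = χ n') (hb : b < N + 1) :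
    ∃ φ : InfFormula m, IsComputablePi (N + 1) φ ∧
      ∀ (M : Type u) [groupLang.Structure M] (v : Fin m → M),
        φ.Sat M v ↔ ∀ n, ∀ y, (χ n).Sat M (Fin.append v y) := by
  obtain ⟨e, ψ, hlevel, hindex, hsat⟩ := exists_W_formulas hi hχ inj
  exact ⟨_, ⟨e, .allConj N e ψ (fun c => (hlevel c).trans_lt hb) hindex⟩,
    fun M _ v => (hsat M v).2⟩

/-- The matrix of `HasPrimitiveRotation`, with `a`, `t`, `x`, `y`, `z` as `x₀, …, x₄`. -/
def primitiveMatrix (n : ℕ) : QF (0 + 2 + 3) :=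
  let a : groupLang.Term (Fin (0 + 2 + 3)) := .var 0
  let t : groupLang.Term (Fin (0 + 2 + 3)) := .var 1
  let x : groupLang.Term (Fin (0 + 2 + 3)) := .var 2
  let y : groupLang.Term (Fin (0 + 2 + 3)) := .var 3
  let z : groupLang.Term (Fin (0 + 2 + 3)) := .var 4
  .and (.eq (tmul (tmul x y) z) (tmul x (tmul y z))) <|
  .and (.eq (tmul tone x) x) <| .and (.eq (tmul (tinv x) x) tone) <|
  .and (.eq (tmul a a) tone) <| .and (.eq (tmul (tmul a t) a) (tinv t)) <|
  .and (.ne (tpow (n + 1) t) tone) (.ne (tpow (n + 2) x) t)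

theorem primrecQF_primitiveMatrix : PrimrecQF primitiveMatrix := by
  refine .and (.const _) <| .and (.const _) <| .and (.const _) <| .and (.const _) <|
    .and (.const _) <| .and (.ne (.pow Primrec.succ _) (.const _)) (.ne (.pow ?_ _) (.const _))
  exact Primrec.succ.comp Primrec.succ

/-- The matrix of `HasCommonRotations`, with `a`, `t`, `x`, `s` as `x₀, …, x₃` and `n = ⟨i, j⟩`. -/
def rotationMatrix (n : ℕ) : QF (0 + 3 + 1) :=
  let a : groupLang.Term (Fin (0 + 3 + 1)) := .var 0
  let t : groupLang.Term (Fin (0 + 3 + 1)) := .var 1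
  let x : groupLang.Term (Fin (0 + 3 + 1)) := .var 2
  let s : groupLang.Term (Fin (0 + 3 + 1)) := .var 3
  .or (.ne (tmul a a) tone) <| .or (.ne (tmul (tmul a t) a) (tinv t)) <|
  .or (.eq (tmul t t) tone) <| .and (.eq (tpow n.unpair.1 s) t) <|
  .or (.eq x (tpow n.unpair.2 s)) <| .or (.eq (tmul x (tpow n.unpair.2 s)) tone) <|
  .or (.eq x (tmul a (tpow n.unpair.2 s))) (.eq (tmul x (tpow n.unpair.2 s)) a)

theorem primrecQF_rotationMatrix : PrimrecQF rotationMatrix := by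
  have h1 : Primrec fun n : ℕ => n.unpair.1 := Primrec.fst.comp Primrec.unpair
  have h2 : Primrec fun n : ℕ => n.unpair.2 := Primrec.snd.comp Primrec.unpair
  exact .or (.const _) <| .or (.const _) <| .or (.const _) <| .and (.eq (.pow h1 _) (.const _)) <|
    .or (.eq (.const _) (.pow h2 _)) <| .or (.eq (.mul (.const _) (.pow h2 _)) (.const _)) <|
    .or (.eq (.const _) (.mul (.const _) (.pow h2 _))) (.eq (.mul (.const _) (.pow h2 _)) (.const _))

/-- A single existential quantifier block over a computable `Π₁` formula, which holds all of the
universal conditions on `a` and `t`, the group axioms included. -/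
theorem exists_isComputableSigma_primitive :
    ∃ σ : InfFormula 0, IsComputableSigma 2 σ ∧
      ∀ (M : Type u) [groupLang.Structure M], σ.Holds M ↔ HasPrimitiveRotation M := by
  obtain ⟨χ, ⟨i, hi⟩, hχ⟩ := exists_isComputablePi.{u} (N := 0) (m := 0 + 2) (k := 3)
    (χ := fun n => .qf (primitiveMatrix n)) primrecQF_primitiveMatrix.to_comp
    (fun n => .qf _ _) (fun n n' h => congrArg _ (QF.code_injective h)) Nat.one_pos
  obtain ⟨σ, hσ, hsat⟩ := exists_isComputableSigma.{u} (N := 1) (m := 0) (k := 2)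
    (χ := fun _ => χ) (Computable.const i) (fun _ => hi) (fun _ _ _ => rfl) Nat.one_lt_two
  refine ⟨σ, hσ, fun M _ => (hsat M _).trans ?_⟩
  simp only [hχ, exists_const]
  constructor
  · rintro ⟨w, h⟩
    refine ⟨w 0, w 1, fun x y z n => ?_⟩
    simpa [InfFormula.Sat, QF.Sat, primitiveMatrix] using! h n ![x, y, z]
  · rintro ⟨a, t, h⟩
    refine ⟨![a, t], fun n w => ?_⟩
    simpa [InfFormula.Sat, QF.Sat, primitiveMatrix] using! h (w 0) (w 1) (w 2) n

theorem exists_isComputablePi_rotations :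
    ∃ π : InfFormula 0, IsComputablePi 2 π ∧
      ∀ (M : Type u) [groupLang.Structure M], π.Holds M ↔ HasCommonRotations M := by
  obtain ⟨χ, ⟨i, hi⟩, hχ⟩ := exists_isComputableSigma.{u} (N := 0) (m := 0 + 3) (k := 1)
    (χ := fun n => .qf (rotationMatrix n)) primrecQF_rotationMatrix.to_comp
    (fun n => .qf _ _) (fun n n' h => congrArg _ (QF.code_injective h)) Nat.one_pos
  obtain ⟨π, hπ, hsat⟩ := exists_isComputablePi.{u} (N := 1) (m := 0) (k := 3)
    (χ := fun _ => χ) (Computable.const i) (fun _ => hi) (fun _ _ _ => rfl) Nat.one_lt_two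
  refine ⟨π, hπ, fun M _ => (hsat M _).trans ?_⟩
  simp only [hχ, forall_const]
  constructor
  · intro h a t x
    obtain ⟨n, w, h⟩ := h ![a, t, x]
    have h' : gmul a a ≠ gone ∨ gmul (gmul a t) a ≠ ginv t ∨ gmul t t = gone ∨
        gpow n.unpair.1 (w 0) = t ∧ (x = gpow n.unpair.2 (w 0) ∨
          gmul x (gpow n.unpair.2 (w 0)) = gone ∨ x = gmul a (gpow n.unpair.2 (w 0)) ∨
          gmul x (gpow n.unpair.2 (w 0)) = a) := by
      simpa [InfFormula.Sat, QF.Sat, rotationMatrix] using! h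
    exact h'.imp_right (Or.imp_right (Or.imp_right fun h => ⟨w 0, _, _, h⟩))
  · intro h w
    obtain ⟨s, i, j, h⟩ : ∃ (s : M) (i j : ℕ), gmul (w 0) (w 0) ≠ gone ∨
        gmul (gmul (w 0) (w 1)) (w 0) ≠ ginv (w 1) ∨ gmul (w 1) (w 1) = gone ∨
        gpow i s = w 1 ∧ (w 2 = gpow j s ∨ gmul (w 2) (gpow j s) = gone ∨
          w 2 = gmul (w 0) (gpow j s) ∨ gmul (w 2) (gpow j s) = w 0) := by
      obtain h | h | h | ⟨s, i, j, h⟩ := h (w 0) (w 1) (w 2)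
      · exact ⟨w 0, 0, 0, Or.inl h⟩
      · exact ⟨w 0, 0, 0, Or.inr (Or.inl h)⟩
      · exact ⟨w 0, 0, 0, Or.inr (Or.inr (Or.inl h))⟩
      · exact ⟨s, i, j, Or.inr (Or.inr (Or.inr h))⟩
    refine ⟨Nat.pair i j, fun _ => s, ?_⟩
    simpa [InfFormula.Sat, QF.Sat, rotationMatrix] using! h

theorem exists_scottSentence :
    ∃ φ : InfFormula 0, IsComputableDSigma 2 φ ∧ IsScottSentence.{u, 0} φ DInfty := by
  obtain ⟨σ, hσ, hσs⟩ := exists_isComputableSigma_primitive.{u}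
  obtain ⟨π, hπ, hπs⟩ := exists_isComputablePi_rotations.{u}
  refine ⟨.and σ π, ⟨σ, π, hσ, hπ, rfl⟩, ?_, fun M _ _ => ?_⟩
  · obtain ⟨d⟩ := nonempty_dihedralGroup_mulEquiv_dInfty
    have : Countable (DihedralGroup 0) :=
      (DihedralGroup.equivSum (n := 0)).injective.countable (β := ℤ ⊕ ℤ)
    exact d.symm.injective.countable
  · rw [nonempty_equiv_dInfty_iff, ← hσs, ← hπs]
    exact Iff.rfl

/-! ### Primitive recursion and `Π⁰₂` predicates -/

attribute [fun_prop] Primrec Primrec.const Primrec.comp Primrec.pair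

section FunProp

variable {α β γ : Type*} [Primcodable α] [Primcodable β] [Primcodable γ]

@[fun_prop] theorem primrec_fun_id : Primrec fun x : α => x := Primrec.id

@[fun_prop] theorem primrec_fun_fst {f : α → β × γ} (hf : Primrec f) : Primrec fun a => (f a).1 :=
  Primrec.fst.comp hf

@[fun_prop] theorem primrec_fun_snd {f : α → β × γ} (hf : Primrec f) : Primrec fun a => (f a).2 :=
  Primrec.snd.comp hf

@[fun_prop] theorem primrec_fun_natPair {f g : α → ℕ} (hf : Primrec f) (hg : Primrec g) :
    Primrec fun a => Nat.pair (f a) (g a) := Primrec₂.natPair.comp hf hg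

@[fun_prop] theorem primrec_fun_unpair {f : α → ℕ} (hf : Primrec f) :
    Primrec fun a => (f a).unpair := Primrec.unpair.comp hf

@[fun_prop] theorem primrec_fun_add {f g : α → ℕ} (hf : Primrec f) (hg : Primrec g) :
    Primrec fun a => f a + g a := Primrec.nat_add.comp hf hg

@[fun_prop] theorem primrec_fun_mul {f g : α → ℕ} (hf : Primrec f) (hg : Primrec g) :
    Primrec fun a => f a * g a := Primrec.nat_mul.comp hf hg

@[fun_prop] theorem primrec_fun_powCode {f g : α → ℕ} (hf : Primrec f) (hg : Primrec g) :
    Primrec fun a => powCode (f a) (g a) := primrec_powCode.comp hf hg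

end FunProp

section Pi02

variable {α : Type*} [Primcodable α]

theorem rePred_eq {f g : α → ℕ} (hf : Primrec f) (hg : Primrec g) : REPred fun a => f a = g a :=
  (PrimrecRel.comp Primrec.eq hf hg).computablePred.to_re

theorem rePred_mem_phi (v : ℕ) {f g : α → ℕ} (hf : Primrec f) (hg : Primrec g) :
    REPred fun a => v ∈ phi (f a) (g a) := by
  refine (rePred_of_computablePred (R := fun a k =>
    Nat.Partrec.Code.evaln k (Denumerable.ofNat Nat.Partrec.Code (f a)) (g a) = some v)
    (PrimrecPred.computablePred ?_)).of_eq fun a => ?_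
  · have h1 : Primrec fun x : α × ℕ =>
        Nat.Partrec.Code.evaln x.2 (Denumerable.ofNat Nat.Partrec.Code (f x.1)) (g x.1) :=
      Nat.Partrec.Code.primrec_evaln.comp
        ((Primrec.snd.pair ((Primrec.ofNat _).comp (hf.comp Primrec.fst))).pair
          (hg.comp Primrec.fst))
    exact PrimrecRel.comp Primrec.eq h1 (Primrec.const _)
  · exact Nat.Partrec.Code.evaln_complete.symm

/-- The predicate `p` is `Π⁰₂`: it is of the form `∀ x, Q (a, x)` with `Q` r.e. -/
def IsPi02 (p : α → Prop) : Prop :=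
  ∃ Q : α × ℕ → Prop, REPred Q ∧ ∀ a, p a ↔ ∀ x, Q (a, x)

theorem _root_.REPred.isPi02 {p : α → Prop} (hp : REPred p) : IsPi02 p :=
  ⟨fun x => p x.1, hp.comp Computable.fst, fun a => by simp⟩

theorem IsPi02.forall_snd {p : α → ℕ → Prop} (hp : IsPi02 fun x : α × ℕ => p x.1 x.2) :
    IsPi02 fun a => ∀ n, p a n := by
  obtain ⟨Q, hQ, h⟩ := hp
  refine ⟨fun x => Q ((x.1, x.2.unpair.1), x.2.unpair.2),
    hQ.comp (Primrec.to_comp (by fun_prop)), fun a => ?_⟩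
  constructor
  · intro h1 x; exact (h (a, _)).1 (h1 _) _
  · intro h1 n; exact (h (a, n)).2 fun x => by simpa using h1 (Nat.pair n x)

theorem IsPi02.and {p q : α → Prop} (hp : IsPi02 p) (hq : IsPi02 q) : IsPi02 fun a => p a ∧ q a := by
  obtain ⟨Q, hQ, h⟩ := hp
  obtain ⟨R, hR, h'⟩ := hq
  exact ⟨fun x => Q x ∧ R x, hQ.and hR, fun a => by simp only [h, h', forall_and]⟩

theorem IsPi02.isSigma02_not {p : ℕ → Prop} (hp : IsPi02 p) : IsSigma02 {e | ¬ p e} := by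
  obtain ⟨Q, hQ, h⟩ := hp
  obtain ⟨R, hR, h'⟩ := hQ.exists_primrecPred
  refine ⟨fun x => ¬ R (x.1, x.2.1) x.2.2, PrimrecPred.computablePred (.not (hR.comp
    (f := fun x : ℕ × ℕ × ℕ => ((x.1, x.2.1), x.2.2)) (by fun_prop))), fun n => ?_⟩
  simp [h, h']

end Pi02

/-! ### Recognizing atomic diagrams -/

/-- Gödel number of a variable. -/
def cvar (i : ℕ) : ℕ := Nat.pair 0 i
/-- Gödel number of the identity. -/
def cone : ℕ := Nat.pair 1 0
/-- Gödel number of an inverse. -/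
def cinv (s : ℕ) : ℕ := Nat.pair 2 s
/-- Gödel number of a product. -/
def cmul (s t : ℕ) : ℕ := Nat.pair 3 (Nat.pair s t)
/-- Gödel number of an equation. -/
def ceq (s t : ℕ) : ℕ := Nat.pair 0 (Nat.pair s t)
/-- Gödel number of a negated equation. -/
def cne (s t : ℕ) : ℕ := Nat.pair 1 (Nat.pair s t)

section FunProp

variable {α : Type*} [Primcodable α] {f g : α → ℕ}

@[fun_prop] theorem primrec_cvar (hf : Primrec f) : Primrec fun a => cvar (f a) := by
  unfold cvar; fun_prop
@[fun_prop] theorem primrec_cinv (hf : Primrec f) : Primrec fun a => cinv (f a) := by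
  unfold cinv; fun_prop
@[fun_prop] theorem primrec_cmul (hf : Primrec f) (hg : Primrec g) :
    Primrec fun a => cmul (f a) (g a) := by
  unfold cmul; fun_prop
@[fun_prop] theorem primrec_ceq (hf : Primrec f) (hg : Primrec g) :
    Primrec fun a => ceq (f a) (g a) := by
  unfold ceq; fun_prop
@[fun_prop] theorem primrec_cne (hf : Primrec f) (hg : Primrec g) :
    Primrec fun a => cne (f a) (g a) := by
  unfold cne; fun_prop

end FunProp

/-- The Gödel number of a term with constants from `B`. -/
def constCode {B : Set ℕ} (s : groupLang.Term B) : ℕ := termCode (s.relabel Subtype.val)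

section ConstCode

variable {B : Set ℕ}

theorem constCode_var (b : B) : constCode (.var b) = cvar b := by
  simp [constCode, cvar, termCode, FirstOrder.Language.Term.relabel]

theorem constCode_tone : constCode (B := B) tone = cone := by
  rw [constCode, relabel_tone, termCode_tone]; rfl

theorem constCode_tinv (s : groupLang.Term B) : constCode (tinv s) = cinv (constCode s) := by
  rw [constCode, relabel_tinv, termCode_tinv]; rfl

theorem constCode_tmul (s t : groupLang.Term B) :
    constCode (tmul s t) = cmul (constCode s) (constCode t) := by
  rw [constCode, relabel_tmul, termCode_tmul]; rfl

theorem constCode_tpow (n : ℕ) (s : groupLang.Term B) :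
    constCode (tpow n s) = powCode n (constCode s) := by
  rw [constCode, relabel_tpow, termCode_tpow]; rfl

/-- Induction on terms, in the form of the four ways to build them. -/
theorem term_induction {α : Type*} {C : groupLang.Term α → Prop} (hvar : ∀ i, C (.var i))
    (hone : C tone) (hinv : ∀ s, C s → C (tinv s)) (hmul : ∀ s t, C s → C t → C (tmul s t))
    (s : groupLang.Term α) : C s := by
  induction s with
  | var i => exact hvar i
  | @func n f ts ih =>
    match n, f, ts, ih with
    | _, GroupFunc.one, ts, ih =>
      rwa [Subsingleton.elim ts (![])]
    | _, GroupFunc.inv, ts, ih =>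
      have : ts = ![ts 0] := funext fun i => by fin_cases i; rfl
      rw [this]; exact hinv _ (ih 0)
    | _, GroupFunc.mul, ts, ih =>
      have : ts = ![ts 0, ts 1] := funext fun i => by fin_cases i <;> rfl
      rw [this]; exact hmul _ _ (ih 0) (ih 1)

theorem constCode_injective : Function.Injective (constCode (B := B)) := by
  refine termCode_injective.comp fun s => ?_
  induction s with
  | var i =>
    rintro (j | ⟨f, us⟩) h <;> simp [FirstOrder.Language.Term.relabel, Subtype.ext_iff] at h ⊢
    exact h
  | func f ts ih =>
    rintro (j | ⟨g, us⟩) h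
    · simp [FirstOrder.Language.Term.relabel] at h
    · simp only [FirstOrder.Language.Term.relabel, FirstOrder.Language.Term.func.injEq] at h
      obtain ⟨rfl, h1, h2⟩ := h
      cases h1
      congr 1; funext i
      exact ih i (congrFun (eq_of_heq h2) i)

theorem constCode_eq_cvar_iff {s : groupLang.Term B} {i : ℕ} :
    cvar i = constCode s ↔ ∃ h : i ∈ B, s = .var ⟨i, h⟩ := by
  constructor
  · intro h
    induction s using term_induction with
    | hvar b =>
      rw [constCode_var] at h
      obtain rfl : i = b := by simpa [cvar] using h
      exact ⟨b.2, rfl⟩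
    | hone => rw [constCode_tone] at h; simp [cvar, cone] at h
    | hinv s => rw [constCode_tinv] at h; simp [cvar, cinv] at h
    | hmul s t => rw [constCode_tmul] at h; simp [cvar, cmul] at h
  · rintro ⟨h, rfl⟩; rw [constCode_var]

theorem ceq_inj {s t s' t' : ℕ} : ceq s t = ceq s' t' ↔ s = s' ∧ t = t' := by simp [ceq]
theorem cne_inj {s t s' t' : ℕ} : cne s t = cne s' t' ↔ s = s' ∧ t = t' := by simp [cne]
theorem ceq_ne_cne {s t s' t' : ℕ} : ceq s t ≠ cne s' t' := by simp [ceq, cne]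

variable [groupLang.Structure B]

theorem mem_atomicDiagram {c : ℕ} : c ∈ atomicDiagram B ↔ ∃ s t : groupLang.Term B,
    (c = ceq (constCode s) (constCode t) ∧ s.realize id = t.realize id) ∨
    (c = cne (constCode s) (constCode t) ∧ s.realize id ≠ t.realize id) := Iff.rfl

theorem ceq_mem_iff {c d : ℕ} : ceq c d ∈ atomicDiagram B ↔ ∃ s t : groupLang.Term B,
    c = constCode s ∧ d = constCode t ∧ s.realize id = t.realize id := by
  simp [mem_atomicDiagram, ceq_inj, ceq_ne_cne, and_assoc]

theorem cne_mem_iff {c d : ℕ} : cne c d ∈ atomicDiagram B ↔ ∃ s t : groupLang.Term B,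
    c = constCode s ∧ d = constCode t ∧ s.realize id ≠ t.realize id := by
  simp [mem_atomicDiagram, cne_inj, ceq_ne_cne.symm, and_assoc]

theorem ceq_constCode_mem_iff {s t : groupLang.Term B} :
    ceq (constCode s) (constCode t) ∈ atomicDiagram B ↔ s.realize id = t.realize id := by
  simp only [ceq_mem_iff, constCode_injective.eq_iff]
  constructor
  · rintro ⟨_, _, rfl, rfl, h⟩; exact h
  · intro h; exact ⟨_, _, rfl, rfl, h⟩

theorem cne_constCode_mem_iff {s t : groupLang.Term B} :
    cne (constCode s) (constCode t) ∈ atomicDiagram B ↔ s.realize id ≠ t.realize id := by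
  simp only [cne_mem_iff, constCode_injective.eq_iff]
  constructor
  · rintro ⟨_, _, rfl, rfl, h⟩; exact h
  · intro h; exact ⟨_, _, rfl, rfl, h⟩

theorem ceq_self_mem_iff {c : ℕ} :
    ceq c c ∈ atomicDiagram B ↔ ∃ s : groupLang.Term B, c = constCode s := by
  rw [ceq_mem_iff]
  constructor
  · rintro ⟨s, _, h, _⟩; exact ⟨s, h⟩
  · rintro ⟨s, h⟩; exact ⟨s, s, h, h, rfl⟩

theorem ceq_cvar_self_mem_iff {i : ℕ} : ceq (cvar i) (cvar i) ∈ atomicDiagram B ↔ i ∈ B := by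
  rw [ceq_self_mem_iff]
  simp only [constCode_eq_cvar_iff]
  exact ⟨fun ⟨_, h, _⟩ => h, fun h => ⟨_, h, rfl⟩⟩

end ConstCode

/-- Closure conditions on a set `Y` of Gödel numbers, with complement `N`, which say that it is the
atomic diagram of a structure with universe a set of numbers. They are positive in `Y` and `N`, so
that they are `Π⁰₂` when both are r.e. A number `s` is the Gödel number of a term if and only if
`Y (ceq s s)`. -/
def DiagramClauses (Y N : ℕ → Prop) : Prop :=
  (∀ c, N c ∨ ∃ s t, Y (ceq s s) ∧ Y (ceq t t) ∧ (c = ceq s t ∨ c = cne s t)) ∧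
  (∀ s, N (ceq s s) ∨ (∃ i, s = cvar i) ∨ s = cone ∨ (∃ r, s = cinv r ∧ Y (ceq r r)) ∨
    ∃ r t, s = cmul r t ∧ Y (ceq r r) ∧ Y (ceq t t)) ∧
  Y (ceq cone cone) ∧
  (∀ s t, N (ceq s t) ∨ Y (ceq t s)) ∧
  (∀ s t r, N (ceq s t) ∨ N (ceq t r) ∨ Y (ceq s r)) ∧
  (∀ s t, N (ceq s t) ∨ Y (ceq (cinv s) (cinv t))) ∧
  (∀ s t s' t', N (ceq s s') ∨ N (ceq t t') ∨ Y (ceq (cmul s t) (cmul s' t'))) ∧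
  (∀ i j, N (ceq (cvar i) (cvar j)) ∨ i = j) ∧
  (∀ s, N (ceq s s) ∨ ∃ i, Y (ceq s (cvar i))) ∧
  (∀ s t, N (ceq s s) ∨ N (ceq t t) ∨ (Y (cne s t) ∧ N (ceq s t)) ∨ (N (cne s t) ∧ Y (ceq s t)))

theorem diagramClauses_atomicDiagram (B : Set ℕ) [groupLang.Structure B] :
    DiagramClauses (· ∈ atomicDiagram B) (· ∉ atomicDiagram B) := by
  simp only [DiagramClauses, ← imp_iff_not_or]
  refine ⟨fun c hc => ?_, fun c hc => ?_, ?_, fun s t hst => ?_, fun s t r hst htr => ?_,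
    fun s t hst => ?_, fun s t s' t' hs ht => ?_, fun i j hij => ?_, fun c hc => ?_,
    fun c d hc hd => ?_⟩
  · obtain ⟨s, t, ⟨h, -⟩ | ⟨h, -⟩⟩ := mem_atomicDiagram.1 hc
    · exact ⟨_, _, ceq_self_mem_iff.2 ⟨s, rfl⟩, ceq_self_mem_iff.2 ⟨t, rfl⟩, Or.inl h⟩
    · exact ⟨_, _, ceq_self_mem_iff.2 ⟨s, rfl⟩, ceq_self_mem_iff.2 ⟨t, rfl⟩, Or.inr h⟩
  · obtain ⟨s, rfl⟩ := ceq_self_mem_iff.1 hc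
    clear hc
    induction s using term_induction with
    | hvar b => exact Or.inl ⟨b, constCode_var b⟩
    | hone => exact Or.inr (Or.inl constCode_tone)
    | hinv s =>
      exact Or.inr (Or.inr (Or.inl ⟨_, constCode_tinv s, ceq_self_mem_iff.2 ⟨s, rfl⟩⟩))
    | hmul s t =>
      exact Or.inr (Or.inr (Or.inr ⟨_, _, constCode_tmul s t, ceq_self_mem_iff.2 ⟨s, rfl⟩,
        ceq_self_mem_iff.2 ⟨t, rfl⟩⟩))
  · exact ceq_self_mem_iff.2 ⟨tone, constCode_tone.symm⟩
  · obtain ⟨s, t, rfl, rfl, h⟩ := ceq_mem_iff.1 hst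
    exact ceq_constCode_mem_iff.2 h.symm
  · obtain ⟨s, t, rfl, rfl, h⟩ := ceq_mem_iff.1 hst
    obtain ⟨t', r, h', rfl, h''⟩ := ceq_mem_iff.1 htr
    obtain rfl := constCode_injective h'
    exact ceq_constCode_mem_iff.2 (h.trans h'')
  · obtain ⟨s, t, rfl, rfl, h⟩ := ceq_mem_iff.1 hst
    rw [← constCode_tinv, ← constCode_tinv, ceq_constCode_mem_iff, realize_tinv, realize_tinv, h]
  · obtain ⟨s, s', rfl, rfl, h⟩ := ceq_mem_iff.1 hs
    obtain ⟨t, t', rfl, rfl, h'⟩ := ceq_mem_iff.1 ht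
    rw [← constCode_tmul, ← constCode_tmul, ceq_constCode_mem_iff, realize_tmul, realize_tmul, h, h']
  · obtain ⟨s, t, hs, ht, h⟩ := ceq_mem_iff.1 hij
    obtain ⟨hi, rfl⟩ := constCode_eq_cvar_iff.1 hs
    obtain ⟨hj, rfl⟩ := constCode_eq_cvar_iff.1 ht
    exact congrArg Subtype.val h
  · obtain ⟨s, rfl⟩ := ceq_self_mem_iff.1 hc
    refine ⟨(s.realize id : B), ?_⟩
    rw [← constCode_var, ceq_constCode_mem_iff]
    rfl
  · obtain ⟨s, rfl⟩ := ceq_self_mem_iff.1 hc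
    obtain ⟨t, rfl⟩ := ceq_self_mem_iff.1 hd
    rw [ceq_constCode_mem_iff, cne_constCode_mem_iff]
    tauto

/-- The universe consists of the constants which occur in `D`, and a term is evaluated to the
constant which `D` equates with it. -/
theorem exists_atomicDiagram_eq {D : Set ℕ} (h : DiagramClauses (· ∈ D) (· ∉ D)) :
    ∃ (B : Set ℕ) (_ : groupLang.Structure B), atomicDiagram B = D := by
  simp only [DiagramClauses, ← imp_iff_not_or] at h
  obtain ⟨hform, hterm, hone, hsymm, htrans, hinv, hmul, hvar, hval, hne⟩ := h
  let B : Set ℕ := {i | ceq (cvar i) (cvar i) ∈ D}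
  have hval' : ∀ s, ceq s s ∈ D → ∃ i : B, ceq s (cvar i) ∈ D := fun s hs => by
    obtain ⟨i, hi⟩ := hval s hs
    exact ⟨⟨i, htrans _ _ _ (hsymm _ _ hi) hi⟩, hi⟩
  obtain ⟨o, ho⟩ := hval' _ hone
  have h1 : ∀ b : B, ∃ i : B, ceq (cinv (cvar b)) (cvar i) ∈ D :=
    fun b => hval' _ (hinv _ _ b.2)
  have h2 : ∀ b c : B, ∃ i : B, ceq (cmul (cvar b) (cvar c)) (cvar i) ∈ D :=
    fun b c => hval' _ (hmul _ _ _ _ b.2 c.2)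
  choose iv hiv using h1
  choose ml hml using h2
  let inst : groupLang.Structure B :=
    { funMap := fun f x => match f, x with
        | GroupFunc.one, _ => o
        | GroupFunc.inv, x => iv (x 0)
        | GroupFunc.mul, x => ml (x 0) (x 1)
      RelMap := fun r _ => r.elim }
  have hreal : ∀ s : groupLang.Term B, ceq (constCode s) (cvar (s.realize id : B)) ∈ D := by
    intro s
    induction s using term_induction with
    | hvar b => rw [constCode_var]; exact b.2
    | hone => rw [constCode_tone, realize_tone]; exact ho
    | hinv s hs =>
      rw [constCode_tinv, realize_tinv]
      exact htrans _ _ _ (hinv _ _ hs) (hiv _)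
    | hmul s t hs ht =>
      rw [constCode_tmul, realize_tmul]
      exact htrans _ _ _ (hmul _ _ _ _ hs ht) (hml _ _)
  have hself : ∀ s : groupLang.Term B, ceq (constCode s) (constCode s) ∈ D := fun s =>
    htrans _ _ _ (hreal s) (hsymm _ _ (hreal s))
  have heq : ∀ s t : groupLang.Term B,
      ceq (constCode s) (constCode t) ∈ D ↔ s.realize id = t.realize id := by
    intro s t
    constructor
    · intro h
      exact Subtype.ext (hvar _ _ (htrans _ _ _ (hsymm _ _ (hreal s)) (htrans _ _ _ h (hreal t))))
    · intro h
      have h3 := hreal s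
      rw [h] at h3
      exact htrans _ _ _ h3 (hsymm _ _ (hreal t))
  have hne' : ∀ s t : groupLang.Term B,
      cne (constCode s) (constCode t) ∈ D ↔ s.realize id ≠ t.realize id := by
    intro s t
    have := hne _ _ (hself s) (hself t)
    rw [ne_eq, ← heq]
    tauto
  -- by recursion on Gödel numbers, the terms which occur in `D` are terms over `B`
  have hcode : ∀ c, ceq c c ∈ D → ∃ s : groupLang.Term B, c = constCode s := by
    intro c
    induction c using Nat.strong_induction_on with
    | _ c ih =>
      intro hc
      obtain ⟨i, rfl⟩ | rfl | ⟨r, rfl, hr⟩ | ⟨r, t, rfl, hr, ht⟩ := hterm c hc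
      · exact ⟨.var ⟨i, hc⟩, (constCode_var (⟨i, hc⟩ : B)).symm⟩
      · exact ⟨tone, constCode_tone.symm⟩
      · obtain ⟨s, rfl⟩ := ih r (by
          have := Nat.add_le_pair 2 r
          simp only [cinv]; omega) hr
        exact ⟨tinv s, (constCode_tinv s).symm⟩
      · have h3 := Nat.add_le_pair 3 (Nat.pair r t)
        have h4 := Nat.add_le_pair r t
        obtain ⟨s, rfl⟩ := ih r (by simp only [cmul]; omega) hr
        obtain ⟨t, rfl⟩ := ih t (by simp only [cmul]; omega) ht
        exact ⟨tmul s t, (constCode_tmul s t).symm⟩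
  refine ⟨B, inst, Set.ext fun c => ?_⟩
  rw [mem_atomicDiagram]
  constructor
  · rintro ⟨s, t, ⟨rfl, h⟩ | ⟨rfl, h⟩⟩
    · exact (heq s t).2 h
    · exact (hne' s t).2 h
  · intro hc
    obtain ⟨s, t, hs, ht, hst⟩ := hform c hc
    obtain ⟨s, rfl⟩ := hcode s hs
    obtain ⟨t, rfl⟩ := hcode t ht
    obtain rfl | rfl := hst
    · exact ⟨s, t, Or.inl ⟨rfl, (heq s t).1 hc⟩⟩
    · exact ⟨s, t, Or.inr ⟨rfl, (hne' s t).1 hc⟩⟩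

/-- `HasCommonRotations`, in terms of the atomic diagram `Y` and its complement `N`. -/
def RotationClauses (Y N : ℕ → Prop) : Prop :=
  ∀ a t x, N (ceq (cvar a) (cvar a)) ∨ N (ceq (cvar t) (cvar t)) ∨ N (ceq (cvar x) (cvar x)) ∨
    N (ceq (cmul (cvar a) (cvar a)) cone) ∨
    N (ceq (cmul (cmul (cvar a) (cvar t)) (cvar a)) (cinv (cvar t))) ∨
    Y (ceq (cmul (cvar t) (cvar t)) cone) ∨
    ∃ s i j, Y (ceq (cvar s) (cvar s)) ∧ Y (ceq (powCode i (cvar s)) (cvar t)) ∧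
      (Y (ceq (cvar x) (powCode j (cvar s))) ∨ Y (ceq (cmul (cvar x) (powCode j (cvar s))) cone) ∨
        Y (ceq (cvar x) (cmul (cvar a) (powCode j (cvar s)))) ∨
        Y (ceq (cmul (cvar x) (powCode j (cvar s))) (cvar a)))

/-- The negation of `HasPrimitiveRotation`, in terms of the atomic diagram `Y` and its complement
`N`. -/
def ImprimitiveClauses (Y N : ℕ → Prop) : Prop :=
  ∀ a t, N (ceq (cvar a) (cvar a)) ∨ N (ceq (cvar t) (cvar t)) ∨
    ∃ x y z n, Y (ceq (cvar x) (cvar x)) ∧ Y (ceq (cvar y) (cvar y)) ∧ Y (ceq (cvar z) (cvar z)) ∧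
      (N (ceq (cmul (cmul (cvar x) (cvar y)) (cvar z)) (cmul (cvar x) (cmul (cvar y) (cvar z)))) ∨
        N (ceq (cmul cone (cvar x)) (cvar x)) ∨ N (ceq (cmul (cinv (cvar x)) (cvar x)) cone) ∨
        N (ceq (cmul (cvar a) (cvar a)) cone) ∨
        N (ceq (cmul (cmul (cvar a) (cvar t)) (cvar a)) (cinv (cvar t))) ∨
        Y (ceq (powCode (n + 1) (cvar t)) cone) ∨ Y (ceq (powCode (n + 2) (cvar x)) (cvar t)))

theorem rotationClauses_iff (B : Set ℕ) [groupLang.Structure B] :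
    RotationClauses (· ∈ atomicDiagram B) (· ∉ atomicDiagram B) ↔ HasCommonRotations B := by
  simp only [RotationClauses, HasCommonRotations, ceq_cvar_self_mem_iff]
  constructor
  · intro h a t x
    have h1 := h a t x
    simp only [Subtype.coe_prop, not_true_eq_false, false_or] at h1
    simp only [← constCode_var, ← constCode_tmul, ← constCode_tinv, ← constCode_tone (B := B),
      ceq_constCode_mem_iff, realize_tmul, realize_tinv, realize_tone,
      FirstOrder.Language.Term.realize_var, id] at h1
    refine h1.imp_right (Or.imp_right (Or.imp_right ?_))
    rintro ⟨s, i, j, hs, h2⟩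
    lift s to B using hs
    refine ⟨s, i, j, ?_⟩
    simpa only [← constCode_var, ← constCode_tmul, ← constCode_tinv, ← constCode_tone (B := B),
      ← constCode_tpow, ceq_constCode_mem_iff, realize_tmul, realize_tinv, realize_tone,
      realize_tpow, FirstOrder.Language.Term.realize_var, id] using h2
  · intro h a t x
    by_cases ha : a ∈ B
    swap; · exact Or.inl ha
    by_cases ht : t ∈ B
    swap; · exact Or.inr (Or.inl ht)
    by_cases hx : x ∈ B
    swap; · exact Or.inr (Or.inr (Or.inl hx))
    refine Or.inr (Or.inr (Or.inr ?_))
    lift a to B using ha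
    lift t to B using ht
    lift x to B using hx
    have h1 := h a t x
    simp only [← constCode_var, ← constCode_tmul, ← constCode_tinv, ← constCode_tone (B := B),
      ceq_constCode_mem_iff, realize_tmul, realize_tinv, realize_tone,
      FirstOrder.Language.Term.realize_var, id]
    refine h1.imp_right (Or.imp_right (Or.imp_right ?_))
    rintro ⟨s, i, j, h2⟩
    refine ⟨s, i, j, s.2, ?_⟩
    simpa only [← constCode_var, ← constCode_tmul, ← constCode_tinv, ← constCode_tone (B := B),
      ← constCode_tpow, ceq_constCode_mem_iff, realize_tmul, realize_tinv, realize_tone,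
      realize_tpow, FirstOrder.Language.Term.realize_var, id] using h2

theorem imprimitiveClauses_iff (B : Set ℕ) [groupLang.Structure B] :
    ImprimitiveClauses (· ∈ atomicDiagram B) (· ∉ atomicDiagram B) ↔ ¬ HasPrimitiveRotation B := by
  have key : ∀ (a t x y z : B) (n : ℕ),
      (ceq (cmul (cmul (cvar x) (cvar y)) (cvar z)) (cmul (cvar x) (cmul (cvar y) (cvar z))) ∉
          atomicDiagram B ∨
        ceq (cmul cone (cvar x)) (cvar x) ∉ atomicDiagram B ∨
        ceq (cmul (cinv (cvar x)) (cvar x)) cone ∉ atomicDiagram B ∨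
        ceq (cmul (cvar a) (cvar a)) cone ∉ atomicDiagram B ∨
        ceq (cmul (cmul (cvar a) (cvar t)) (cvar a)) (cinv (cvar t)) ∉ atomicDiagram B ∨
        ceq (powCode (n + 1) (cvar t)) cone ∈ atomicDiagram B ∨
        ceq (powCode (n + 2) (cvar x)) (cvar t) ∈ atomicDiagram B) ↔
      ¬ (gmul (gmul x y) z = gmul x (gmul y z) ∧ gmul gone x = x ∧ gmul (ginv x) x = gone ∧
        gmul a a = gone ∧ gmul (gmul a t) a = ginv t ∧
        gpow (n + 1) t ≠ gone ∧ gpow (n + 2) x ≠ t) := by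
    intro a t x y z n
    simp only [← constCode_var, ← constCode_tmul, ← constCode_tinv, ← constCode_tone (B := B),
      ← constCode_tpow, ceq_constCode_mem_iff, realize_tmul, realize_tinv, realize_tone,
      realize_tpow, FirstOrder.Language.Term.realize_var, id, ne_eq, not_and_or, not_not]
  simp only [ImprimitiveClauses, HasPrimitiveRotation, ceq_cvar_self_mem_iff, not_exists, not_forall]
  constructor
  · intro h a t
    have h1 := h a t
    simp only [Subtype.coe_prop, not_true_eq_false, false_or] at h1
    obtain ⟨x, y, z, n, hx, hy, hz, h2⟩ := h1
    exact ⟨⟨x, hx⟩, ⟨y, hy⟩, ⟨z, hz⟩, n, (key a t ⟨x, hx⟩ ⟨y, hy⟩ ⟨z, hz⟩ n).1 h2⟩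
  · intro h a t
    by_cases ha : a ∈ B
    swap; · exact Or.inl ha
    by_cases ht : t ∈ B
    swap; · exact Or.inr (Or.inl ht)
    obtain ⟨x, y, z, n, h2⟩ := h ⟨a, ha⟩ ⟨t, ht⟩
    exact Or.inr (Or.inr ⟨x, y, z, n, x.2, y.2, z.2, (key ⟨a, ha⟩ ⟨t, ht⟩ x y z n).2 h2⟩)

/-- The clauses, applied to the programs `e` whose values are `0` and `1`. -/
theorem mem_indexSet_dInfty_iff (e : ℕ) : e ∈ indexSet DInfty ↔
    ((∀ c, 1 ∈ phi e c ∨ 0 ∈ phi e c) ∧ DiagramClauses (1 ∈ phi e ·) (0 ∈ phi e ·) ∧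
      RotationClauses (1 ∈ phi e ·) (0 ∈ phi e ·)) ∧
    ¬ ImprimitiveClauses (1 ∈ phi e ·) (0 ∈ phi e ·) := by
  constructor
  · rintro ⟨B, inst, hB, hphi⟩
    have h1 : (1 ∈ phi e ·) = (· ∈ atomicDiagram B) := by
      funext c
      rw [hphi c, Part.mem_some_iff, charFun]
      split_ifs with h <;> simp [h]
    have h0 : (0 ∈ phi e ·) = (· ∉ atomicDiagram B) := by
      funext c
      rw [hphi c, Part.mem_some_iff, charFun]
      split_ifs with h <;> simp [h]
    have hB' := nonempty_equiv_dInfty_iff.1 hB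
    refine ⟨⟨fun c => ?_, ?_, ?_⟩, ?_⟩
    · rw [congrFun h1 c, congrFun h0 c]; exact em _
    · rw [h1, h0]; exact diagramClauses_atomicDiagram B
    · rw [h1, h0]; exact (rotationClauses_iff B).2 hB'.2
    · rw [h1, h0, imprimitiveClauses_iff, not_not]; exact hB'.1
  · rintro ⟨⟨htot, hdiag, hrot⟩, hprim⟩
    let D : Set ℕ := {c | 1 ∈ phi e c}
    have h0 : (0 ∈ phi e ·) = (· ∉ D) := by
      funext c
      refine propext ⟨fun h h' => zero_ne_one (Part.mem_unique h h'), fun h => ?_⟩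
      exact (htot c).resolve_left h
    have h1 : (1 ∈ phi e ·) = (· ∈ D) := rfl
    rw [h0, h1] at hdiag hrot hprim
    obtain ⟨B, inst, hBD⟩ := exists_atomicDiagram_eq hdiag
    rw [← hBD] at hrot hprim
    rw [rotationClauses_iff] at hrot
    rw [imprimitiveClauses_iff, not_not] at hprim
    refine ⟨B, inst, nonempty_equiv_dInfty_iff.2 ⟨hprim, hrot⟩, fun c => ?_⟩
    rw [hBD, charFun]
    split_ifs with h
    · exact Part.eq_some_iff.2 h
    · exact Part.eq_some_iff.2 ((htot c).resolve_left h)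

/-- The clauses become `Π⁰₂` predicates quantifier by quantifier: both `1 ∈ phi e c` and `0 ∈ phi e c`
are r.e. -/
theorem isDSigma02_indexSet : IsDSigma02 (indexSet DInfty) := by
  have hpi : IsPi02 fun e => (∀ c, 1 ∈ phi e c ∨ 0 ∈ phi e c) ∧
      DiagramClauses (1 ∈ phi e ·) (0 ∈ phi e ·) ∧ RotationClauses (1 ∈ phi e ·) (0 ∈ phi e ·) := by
    unfold DiagramClauses RotationClauses
    repeat' first
      | apply IsPi02.and
      | apply IsPi02.forall_snd
      | apply REPred.isPi02
      | apply REPred.or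
      | apply REPred.and
      | apply REPred.exists_snd
      | exact rePred_mem_phi _ (by fun_prop) (by fun_prop)
      | exact rePred_eq (by fun_prop) (by fun_prop)
  have himp : IsPi02 fun e => ImprimitiveClauses (1 ∈ phi e ·) (0 ∈ phi e ·) := by
    unfold ImprimitiveClauses
    repeat' first
      | apply IsPi02.forall_snd
      | apply REPred.isPi02
      | apply REPred.or
      | apply REPred.and
      | apply REPred.exists_snd
      | exact rePred_mem_phi _ (by fun_prop) (by fun_prop)
  refine ⟨_, _, himp.isSigma02_not, hpi.isSigma02_not, Set.ext fun e => ?_⟩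
  rw [mem_indexSet_dInfty_iff, Set.mem_sdiff, Set.mem_ofPred_eq, Set.mem_ofPred_eq, not_not, and_comm]

/-! ### Isometries of the rational line -/

/-- The isometry `y ↦ shift + y` of the rational line, or `y ↦ shift - y` if `flip` is `true`. -/
@[ext]
structure Motion : Type where
  shift : ℚ
  flip : Bool

namespace Motion

instance : Mul Motion :=
  ⟨fun g h => ⟨g.shift + bif g.flip then -h.shift else h.shift, xor g.flip h.flip⟩⟩

instance : One Motion := ⟨⟨0, false⟩⟩

instance : Inv Motion := ⟨fun g => ⟨bif g.flip then g.shift else -g.shift, g.flip⟩⟩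

theorem mul_def (g h : Motion) : g * h =
    ⟨g.shift + bif g.flip then -h.shift else h.shift, xor g.flip h.flip⟩ := rfl
theorem one_def : (1 : Motion) = ⟨0, false⟩ := rfl
theorem inv_def (g : Motion) : g⁻¹ = ⟨bif g.flip then g.shift else -g.shift, g.flip⟩ := rfl

instance : Group Motion := Group.ofLeftAxioms
  (by rintro ⟨x, _ | _⟩ ⟨y, _ | _⟩ ⟨z, _ | _⟩ <;> simp [mul_def] <;> ring)
  (by rintro ⟨x, _ | _⟩ <;> simp [mul_def, one_def])
  (by rintro ⟨x, _ | _⟩ <;> simp [mul_def, one_def, inv_def])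

theorem translation_zpow (x : ℚ) (i : ℤ) : (⟨x, false⟩ : Motion) ^ i = ⟨i * x, false⟩ := by
  let f : Multiplicative ℚ →* Motion :=
    { toFun := fun y => ⟨y.toAdd, false⟩
      map_one' := rfl
      map_mul' := fun _ _ => rfl }
  have := map_zpow f (Multiplicative.ofAdd x) i
  rw [← ofAdd_zsmul, zsmul_eq_mul] at this
  exact this.symm

theorem mul_self_of_flip {g : Motion} (h : g.flip = true) : g * g = 1 := by
  obtain ⟨x, _ | _⟩ := g
  · simp at h
  · simp [mul_def, one_def]

end Motion

/-- The isometries whose shift is a fraction with denominator `2 ^ k`, for some `k ∈ P`, where `P`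
is an initial segment of `ℕ` which contains `0`. -/
def motionSubgroup (P : ℕ → Prop) (h0 : P 0) (_ : ∀ k l, k ≤ l → P l → P k) : Subgroup Motion where
  carrier := {g | ∃ (z : ℤ) (k : ℕ), P k ∧ g.shift = z / 2 ^ k}
  one_mem' := ⟨0, 0, h0, by simp [Motion.one_def]⟩
  inv_mem' := by
    rintro ⟨x, b⟩ ⟨z, k, hk, hx⟩
    refine ⟨bif b then z else -z, k, hk, ?_⟩
    cases b <;> simp_all [Motion.inv_def, neg_div]
  mul_mem' := by
    rintro ⟨x, b⟩ ⟨y, c⟩ ⟨z, k, hk, hx⟩ ⟨w, l, hl, hy⟩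
    have hkl : P (max k l) := by
      rcases le_total k l with h | h
      · rwa [max_eq_right h]
      · rwa [max_eq_left h]
    simp only at hx hy
    have h1 : x = (z * 2 ^ (max k l - k) : ℤ) / 2 ^ max k l := by
      rw [hx, div_eq_div_iff (by positivity) (by positivity)]
      push_cast
      rw [mul_assoc, ← pow_add, Nat.sub_add_cancel (le_max_left k l)]
    have h2 : y = (w * 2 ^ (max k l - l) : ℤ) / 2 ^ max k l := by
      rw [hy, div_eq_div_iff (by positivity) (by positivity)]
      push_cast
      rw [mul_assoc, ← pow_add, Nat.sub_add_cancel (le_max_right k l)]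
    refine ⟨z * 2 ^ (max k l - k) + bif b then -(w * 2 ^ (max k l - l)) else
      w * 2 ^ (max k l - l), _, hkl, ?_⟩
    rw [Motion.mul_def]
    cases b
    · simp only [cond_false]
      rw [h1, h2, ← add_div, Int.cast_add]
    · simp only [cond_true]
      rw [h1, h2, ← neg_div, ← add_div, Int.cast_add, Int.cast_neg]

section MotionSubgroup

variable {P : ℕ → Prop} {h0 : P 0} {hP : ∀ k l, k ≤ l → P l → P k}

/-- If `2 ^ m` is the largest denominator, then all translations are multiples of `1 / 2 ^ m`. -/
theorem nonempty_mulEquiv_motionSubgroup {m : ℕ} (hm : ∀ k, P k ↔ k ≤ m) :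
    Nonempty (DihedralGroup 0 ≃* motionSubgroup P h0 hP) := by
  let a : motionSubgroup P h0 hP := ⟨⟨0, true⟩, 0, 0, h0, by simp⟩
  let t : motionSubgroup P h0 hP := ⟨⟨1 / 2 ^ m, false⟩, 1, m, (hm m).2 le_rfl, by simp⟩
  have hpow : ∀ i : ℤ, ((t ^ i : motionSubgroup P h0 hP) : Motion) = ⟨i / 2 ^ m, false⟩ := by
    intro i
    rw [SubgroupClass.coe_zpow, Motion.translation_zpow, mul_one_div]
  refine nonempty_mulEquiv_dihedralGroup (a := a) (t := t) ?_ ?_ ?_ ?_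
  · exact Subtype.ext (Motion.mul_self_of_flip rfl)
  · refine Subtype.ext ?_
    simp [a, t, Motion.mul_def, Motion.inv_def]
  · intro n hn
    have h1 := congrArg Subtype.val hn
    rw [← zpow_natCast, hpow] at h1
    have h2 := congrArg Motion.shift h1
    have h3 : ((n + 1 : ℕ) : ℚ) / 2 ^ m = 0 := by simpa [Motion.one_def] using h2
    rw [div_eq_zero_iff] at h3
    rcases h3 with h3 | h3
    · exact Nat.succ_ne_zero n (by exact_mod_cast h3)
    · exact absurd h3 (by positivity)
  · rintro ⟨⟨x, b⟩, z, k, hk, hx⟩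
    have h1 : x = (z * 2 ^ (m - k) : ℤ) / 2 ^ m := by
      simp only at hx
      rw [hx, div_eq_div_iff (by positivity) (by positivity)]
      push_cast
      rw [mul_assoc, ← pow_add, Nat.sub_add_cancel ((hm k).1 hk)]
    cases b
    · refine ⟨z * 2 ^ (m - k), Or.inl (Subtype.ext ?_)⟩
      change (⟨x, false⟩ : Motion) = ((t ^ (z * 2 ^ (m - k)) : motionSubgroup P h0 hP) : Motion)
      rw [hpow]
      exact Motion.ext h1 rfl
    · refine ⟨-(z * 2 ^ (m - k)), Or.inr (Subtype.ext ?_)⟩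
      rw [Subgroup.coe_mul, hpow, Int.cast_neg, neg_div, ← h1]
      simp [a, Motion.mul_def]

/-- Each rotation is a square if all denominators `2 ^ k` are allowed. -/
theorem not_hasPrimitiveRotation_motionSubgroup (hall : ∀ k, P k) :
    ¬ @HasPrimitiveRotation (motionSubgroup P h0 hP) (groupStructure _) := by
  let _ := groupStructure (motionSubgroup P h0 hP)
  rintro ⟨a, t, h⟩
  obtain ⟨-, -, -, -, -, -, h1⟩ := h 1 1 1 0
  obtain ⟨-, -, -, -, -, h2, -⟩ := h 1 1 1 1
  rw [gone_group, gpow_group, pow_two] at h2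
  obtain ⟨⟨x, b⟩, z, k, hk, hx⟩ := t
  cases b
  · simp only at hx
    -- the translation by half of the shift
    let s : motionSubgroup P h0 hP := ⟨⟨x / 2, false⟩, z, k + 1, hall _, by
      simp only [hx]; rw [pow_succ, div_div]⟩
    obtain ⟨-, -, -, -, -, -, h1⟩ := h s 1 1 0
    rw [gpow_group, pow_two] at h1
    exact h1 (Subtype.ext (by simp [s, Motion.mul_def]))
  · exact h2 (Subtype.ext (Motion.mul_self_of_flip rfl))

end MotionSubgroup

/-! ### Computing with isometries -/

/-- The quadruple `(p, q, k, b)` denotes the isometry with shift `(p - q) / 2 ^ k` which reverses the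
line if `b` is `true`. -/
abbrev Quad : Type := ℕ × ℕ × ℕ × Bool

namespace Quad

/-- The isometry denoted by a quadruple. -/
def toMotion (v : Quad) : Motion := ⟨((v.1 : ℚ) - v.2.1) / 2 ^ v.2.2.1, v.2.2.2⟩

/-- Product of isometries, in terms of quadruples. -/
def mul (v w : Quad) : Quad :=
  (v.1 * 2 ^ w.2.2.1 + (bif v.2.2.2 then w.2.1 else w.1) * 2 ^ v.2.2.1,
    v.2.1 * 2 ^ w.2.2.1 + (bif v.2.2.2 then w.1 else w.2.1) * 2 ^ v.2.2.1,
    v.2.2.1 + w.2.2.1, xor v.2.2.2 w.2.2.2)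

/-- Inverse of isometries, in terms of quadruples. -/
def inv (v : Quad) : Quad := bif v.2.2.2 then v else (v.2.1, v.1, v.2.2)

/-- Two quadruples denote the same isometry. -/
def Same (v w : Quad) : Prop :=
  v.1 * 2 ^ w.2.2.1 + w.2.1 * 2 ^ v.2.2.1 = w.1 * 2 ^ v.2.2.1 + v.2.1 * 2 ^ w.2.2.1 ∧
    v.2.2.2 = w.2.2.2

theorem toMotion_mul (v w : Quad) : (mul v w).toMotion = v.toMotion * w.toMotion := by
  obtain ⟨p, q, k, b⟩ := v
  obtain ⟨p', q', k', b'⟩ := w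
  cases b <;> simp only [toMotion, mul, Motion.mul_def, cond_true, cond_false] <;> congr 1 <;>
    field_simp <;> push_cast <;> ring

theorem toMotion_inv (v : Quad) : (inv v).toMotion = v.toMotion⁻¹ := by
  obtain ⟨p, q, k, b⟩ := v
  cases b
  · simp only [toMotion, inv, Motion.inv_def, cond_false]
    congr 1
    ring
  · rfl

theorem toMotion_one : toMotion (0, 0, 0, false) = 1 := by simp [toMotion, Motion.one_def]

theorem same_iff (v w : Quad) : Same v w ↔ v.toMotion = w.toMotion := by
  obtain ⟨p, q, k, b⟩ := v
  obtain ⟨p', q', k', b'⟩ := w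
  simp only [Same, toMotion, Motion.mk.injEq]
  refine and_congr_left fun _ => ?_
  rw [div_eq_div_iff (by positivity) (by positivity), ← @Nat.cast_inj ℚ]
  push_cast
  constructor <;> intro h <;> linear_combination h

instance (v w : Quad) : Decidable (Same v w) := inferInstanceAs (Decidable (_ ∧ _))

end Quad

section FunProp

variable {α β : Type*} [Primcodable α] [Primcodable β]

@[fun_prop] theorem primrec_fun_pow {f g : α → ℕ} (hf : Primrec f) (hg : Primrec g) :
    Primrec fun a => f a ^ g a :=
  (Primrec₂.unpaired'.1 Nat.Primrec.pow).comp hf hg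

@[fun_prop] theorem primrec_fun_cond {c : α → Bool} {f g : α → β} (hc : Primrec c) (hf : Primrec f)
    (hg : Primrec g) : Primrec fun a => bif c a then f a else g a := Primrec.cond hc hf hg

@[fun_prop] theorem primrec_fun_xor {f g : α → Bool} (hf : Primrec f) (hg : Primrec g) :
    Primrec fun a => xor (f a) (g a) := (Primrec.dom_bool₂ xor).comp hf hg

@[fun_prop] theorem primrec_quadMul {f g : α → Quad} (hf : Primrec f) (hg : Primrec g) :
    Primrec fun a => Quad.mul (f a) (g a) := by unfold Quad.mul; fun_prop

@[fun_prop] theorem primrec_quadInv {f : α → Quad} (hf : Primrec f) :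
    Primrec fun a => Quad.inv (f a) := by unfold Quad.inv; fun_prop

theorem primrecPred_same {f g : α → Quad} (hf : Primrec f) (hg : Primrec g) :
    PrimrecPred fun a => Quad.Same (f a) (g a) := by
  unfold Quad.Same
  exact (PrimrecRel.comp Primrec.eq (by fun_prop) (by fun_prop)).and
    (PrimrecRel.comp Primrec.eq (by fun_prop) (by fun_prop))

end FunProp

/-- The value of the term with Gödel number `s`, if the constant `i` denotes the quadruple `d i`;
`none` if there is no such term, or if `d` is undefined at one of its constants. -/
def evalCode (d : ℕ → Option Quad) (s : ℕ) : Option Quad :=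
  if s.unpair.1 = 0 then d s.unpair.2
  else if s.unpair.1 = 1 then if s.unpair.2 = 0 then some (0, 0, 0, false) else none
  else if s.unpair.1 = 2 then (evalCode d s.unpair.2).map Quad.inv
  else if s.unpair.1 = 3 then
    (evalCode d s.unpair.2.unpair.1).bind fun v =>
      (evalCode d s.unpair.2.unpair.2).map fun w => Quad.mul v w
  else none
termination_by s
decreasing_by
  all_goals
    have h1 := Nat.add_le_pair s.unpair.1 s.unpair.2
    rw [Nat.pair_unpair] at h1
    have h2 := Nat.unpair_left_le s.unpair.2
    have h3 := Nat.unpair_right_le s.unpair.2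
    omega

section EvalCode

variable {d : ℕ → Option Quad}

theorem evalCode_cvar (i : ℕ) : evalCode d (cvar i) = d i := by
  rw [evalCode]; simp [cvar]

theorem evalCode_cone : evalCode d cone = some (0, 0, 0, false) := by
  rw [evalCode]; simp [cone]

theorem evalCode_cinv (s : ℕ) : evalCode d (cinv s) = (evalCode d s).map Quad.inv := by
  rw [evalCode]; simp [cinv]

theorem evalCode_cmul (s t : ℕ) : evalCode d (cmul s t) =
    (evalCode d s).bind fun v => (evalCode d t).map fun w => Quad.mul v w := by
  rw [evalCode]; simp [cmul]

theorem exists_of_evalCode_eq_some {s : ℕ} {v : Quad} (h : evalCode d s = some v) :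
    (∃ i, s = cvar i ∧ d i = some v) ∨ s = cone ∨ (∃ r w, s = cinv r ∧ evalCode d r = some w) ∨
    ∃ r t w w', s = cmul r t ∧ evalCode d r = some w ∧ evalCode d t = some w' := by
  obtain ⟨x, rfl⟩ : ∃ x : ℕ × ℕ, s = Nat.pair x.1 x.2 := ⟨s.unpair, (Nat.pair_unpair s).symm⟩
  obtain ⟨tag, r⟩ := x
  rw [evalCode] at h
  simp only [Nat.unpair_pair] at h
  split_ifs at h with h0 h1 h1' h2 h3
  · subst h0; exact Or.inl ⟨r, rfl, h⟩
  · subst h1 h1'; exact Or.inr (Or.inl rfl)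
  · subst h2
    obtain ⟨w, hw, -⟩ := Option.map_eq_some_iff.1 h
    exact Or.inr (Or.inr (Or.inl ⟨r, w, rfl, hw⟩))
  · subst h3
    obtain ⟨w, hw, h⟩ := Option.bind_eq_some_iff.1 h
    obtain ⟨w', hw', -⟩ := Option.map_eq_some_iff.1 h
    exact Or.inr (Or.inr (Or.inr ⟨_, _, w, w', by rw [cmul, Nat.pair_unpair], hw, hw'⟩))

end EvalCode

theorem primrec_evalCode {α : Type*} [Primcodable α] {d : α → ℕ → Option Quad} (hd : Primrec₂ d) :
    Primrec₂ fun a s => evalCode (d a) s := by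
  -- one step of the recursion, from the list of the values at all smaller numbers
  let g : α → List (Option Quad) → Option Quad := fun a l =>
    if l.length.unpair.1 = 0 then d a l.length.unpair.2
    else if l.length.unpair.1 = 1 then
      if l.length.unpair.2 = 0 then some (0, 0, 0, false) else none
    else if l.length.unpair.1 = 2 then (l.getD l.length.unpair.2 none).map Quad.inv
    else if l.length.unpair.1 = 3 then
      (l.getD l.length.unpair.2.unpair.1 none).bind fun v =>
        (l.getD l.length.unpair.2.unpair.2 none).map fun w => Quad.mul v w
    else none
  have hlen : Primrec fun x : α × List (Option Quad) => x.2.length :=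
    Primrec.list_length.comp Primrec.snd
  have h1 : Primrec fun x : α × List (Option Quad) => x.2.length.unpair.1 := by fun_prop
  have h2 : Primrec fun x : α × List (Option Quad) => x.2.length.unpair.2 := by fun_prop
  have htag : ∀ i, PrimrecPred fun x : α × List (Option Quad) => x.2.length.unpair.1 = i := fun i =>
    PrimrecRel.comp Primrec.eq h1 (Primrec.const i)
  have hget : ∀ {f : α × List (Option Quad) → ℕ}, Primrec f →
      Primrec fun x : α × List (Option Quad) => x.2.getD (f x) none := fun hf =>
    (Primrec.list_getD none).comp Primrec.snd hf
  have hg : Primrec₂ g := by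
    refine Primrec.ite (htag 0) (hd.comp Primrec.fst h2) <| Primrec.ite (htag 1)
      (Primrec.ite (PrimrecRel.comp Primrec.eq h2 (Primrec.const 0)) (Primrec.const _)
        (Primrec.const _)) <|
      Primrec.ite (htag 2) (Primrec.option_map (hget h2) ?_) <|
      Primrec.ite (htag 3) (Primrec.option_bind (hget (primrec_fun_fst (primrec_fun_unpair h2))) ?_)
        (Primrec.const _)
    · exact primrec_quadInv Primrec.snd
    · refine Primrec.option_map
        ((hget (primrec_fun_snd (primrec_fun_unpair h2))).comp Primrec.fst) ?_
      exact primrec_quadMul (Primrec.snd.comp Primrec.fst) Primrec.snd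
  refine Primrec.nat_strong_rec _ (g := fun a l => some (g a l)) (Primrec.option_some.comp hg)
    fun a s => congrArg some ?_
  have h1 : ∀ r, r < s → ((List.range s).map (evalCode (d a))).getD r none = evalCode (d a) r := by
    intro r hr
    simp [List.getD, hr]
  have h3 := Nat.add_le_pair s.unpair.1 s.unpair.2
  rw [Nat.pair_unpair] at h3
  have h4 := Nat.unpair_left_le s.unpair.2
  have h5 := Nat.unpair_right_le s.unpair.2
  rw [evalCode]
  simp only [g, List.length_map, List.length_range]
  split_ifs
  · rfl
  · rfl
  · rfl
  · rw [h1 _ (by omega)]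
  · rw [h1 _ (by omega), h1 _ (by omega)]
  · rfl

/-! ### A computable group attached to a `Σ⁰₂` question -/

/-- The number `i`, as a bound `m` followed by a quadruple; the parity of the last of five numbers
gives the Boolean. -/
def decodeQuad (i : ℕ) : ℕ × Quad :=
  let x := Denumerable.ofNat (ℕ × ℕ × ℕ × ℕ × ℕ) i
  (x.1, x.2.1, x.2.2.1, x.2.2.2.1, x.2.2.2.2.bodd)

theorem exists_decodeQuad_eq (x : ℕ × Quad) : ∃ i, decodeQuad i = x := by
  obtain ⟨m, p, q, k, b⟩ := x
  refine ⟨Encodable.encode ((m, p, q, k, b.toNat) : ℕ × ℕ × ℕ × ℕ × ℕ), ?_⟩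
  cases b <;> simp only [decodeQuad, Denumerable.ofNat_encode] <;> rfl

/-- The denominator `2 ^ k` is allowed if each `x < k` is refuted, `F x y` meaning that `y` refutes
`x`. -/
def Allowed (F : ℕ → ℕ → Prop) (k : ℕ) : Prop := ∀ x < k, ∃ y, F x y

/-- The denominator of the quadruple coded by `i` is seen to be allowed below the bound coded by
`i`. -/
def Valid (F : ℕ → ℕ → Prop) (i : ℕ) : Prop :=
  ∀ x < (decodeQuad i).2.2.2.1, ∃ y < (decodeQuad i).1, F x y

/-- The least valid codes of isometries: each isometry with an allowed denominator has exactly one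
such code. -/
def codeSet (F : ℕ → ℕ → Prop) : Set ℕ :=
  {i | Valid F i ∧ ∀ j < i, ¬ (Valid F j ∧ Quad.Same (decodeQuad j).2 (decodeQuad i).2)}

open Classical in
/-- The quadruple which an element of the universe `codeSet F` denotes. -/
noncomputable def constQuad (F : ℕ → ℕ → Prop) (i : ℕ) : Option Quad :=
  if i ∈ codeSet F then some (decodeQuad i).2 else none

theorem allowed_zero (F : ℕ → ℕ → Prop) : Allowed F 0 := fun _ h => absurd h (Nat.not_lt_zero _)

theorem Allowed.anti (F : ℕ → ℕ → Prop) (k l : ℕ) (h : k ≤ l) (hl : Allowed F l) : Allowed F k :=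
  fun x hx => hl x (hx.trans_le h)

/-- The isometries with allowed denominators. -/
abbrev allowedGroup (F : ℕ → ℕ → Prop) : Subgroup Motion :=
  motionSubgroup (Allowed F) (allowed_zero F) (Allowed.anti F)

section CodeSet

variable (F : ℕ → ℕ → Prop)

theorem Allowed.exists_bound {F : ℕ → ℕ → Prop} {k : ℕ} (h : Allowed F k) :
    ∃ m, ∀ x < k, ∃ y < m, F x y := by
  choose! f hf using h
  refine ⟨(Finset.range k).sup f + 1, fun x hx => ⟨f x, ?_, hf x hx⟩⟩
  exact Nat.lt_succ_of_le (Finset.le_sup (Finset.mem_range.2 hx))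

/-- The isometry denoted by an element of the universe. -/
def codeMotion (i : codeSet F) : allowedGroup F :=
  ⟨(decodeQuad i).2.toMotion, ((decodeQuad i).2.1 : ℤ) - (decodeQuad i).2.2.1,
    (decodeQuad i).2.2.2.1, fun x hx => (i.2.1 x hx).imp fun _ h => h.2, by simp [Quad.toMotion]⟩

theorem codeMotion_bijective : Function.Bijective (codeMotion F) := by
  constructor
  · intro i j h
    have h1 : (decodeQuad i).2.toMotion = (decodeQuad j).2.toMotion := congrArg Subtype.val h
    rcases lt_trichotomy (i : ℕ) j with hij | hij | hij
    · exact (j.2.2 _ hij ⟨i.2.1, (Quad.same_iff _ _).2 h1⟩).elim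
    · exact Subtype.ext hij
    · exact (i.2.2 _ hij ⟨j.2.1, (Quad.same_iff _ _).2 h1.symm⟩).elim
  · rintro ⟨⟨x, b⟩, z, k, hk, hx⟩
    obtain ⟨m, hm⟩ := hk.exists_bound
    -- the integer `z` is written as the difference of its positive and negative parts
    have hex : ∃ i, Valid F i ∧ (decodeQuad i).2.toMotion = ⟨x, b⟩ := by
      obtain ⟨i, hi⟩ := exists_decodeQuad_eq (m, z.toNat, (-z).toNat, k, b)
      refine ⟨i, ?_, ?_⟩
      · rw [Valid, hi]; exact hm
      · rw [hi]
        refine Motion.ext ?_ rfl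
        have h1 : ((z.toNat : ℤ) : ℚ) - (((-z).toNat : ℤ) : ℚ) = z := by
          rw [← Int.cast_sub, Int.toNat_sub_toNat_neg]
        rw [Int.cast_natCast, Int.cast_natCast] at h1
        change ((z.toNat : ℚ) - ((-z).toNat : ℚ)) / 2 ^ k = x
        rw [h1]
        exact hx.symm
    classical
    refine ⟨⟨Nat.find hex, (Nat.find_spec hex).1, fun j hj h => ?_⟩,
      Subtype.ext (Nat.find_spec hex).2⟩
    exact Nat.find_min hex hj ⟨h.1, ((Quad.same_iff _ _).1 h.2).trans (Nat.find_spec hex).2⟩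

/-- The elements of `codeSet F` are names for the elements of `allowedGroup F`. -/
noncomputable def codeEquiv : codeSet F ≃ allowedGroup F :=
  Equiv.ofBijective _ (codeMotion_bijective F)

/-- The structure on `codeSet F` which makes it a copy of `allowedGroup F`. -/
noncomputable instance codeStructure : groupLang.Structure (codeSet F) :=
  @_root_.Equiv.inducedStructure groupLang _ _ (groupStructure (allowedGroup F)) (codeEquiv F).symm

/-- `codeEquiv`, as an isomorphism of structures. -/
noncomputable def codeStructureEquiv :
    @FirstOrder.Language.Equiv groupLang (codeSet F) (allowedGroup F) _ (groupStructure _) :=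
  letI := groupStructure (allowedGroup F)
  (_root_.Equiv.inducedStructureEquiv (L := groupLang) (codeEquiv F).symm).symm

theorem codeEquiv_apply (i : codeSet F) : (codeEquiv F i : Motion) = (decodeQuad i).2.toMotion := rfl

/-- With `k` the least number that is not refuted, the allowed denominators are `1, …, 2 ^ k`; without
such a number all denominators are allowed. -/
theorem nonempty_codeSet_equiv_dInfty_iff :
    Nonempty (codeSet F ≃[groupLang] DInfty) ↔ ∃ k, ∀ y, ¬ F k y := by
  let _ := groupStructure (allowedGroup F)
  constructor
  · rintro h
    by_contra! h1
    have h2 := (nonempty_equiv_dInfty_iff.1 h).1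
    exact not_hasPrimitiveRotation_motionSubgroup (P := Allowed F) (fun k x _ => h1 x)
      (h2.of_equiv (codeStructureEquiv F).symm)
  · intro h
    classical
    have hm : ∀ k, Allowed F k ↔ k ≤ Nat.find h := by
      intro k
      constructor
      · intro hk
        by_contra! hlt
        obtain ⟨y, hy⟩ := hk _ hlt
        exact Nat.find_spec h y hy
      · intro hk x hx
        simpa using Nat.find_min h (hx.trans_le hk)
    obtain ⟨d⟩ := nonempty_mulEquiv_motionSubgroup (h0 := allowed_zero F) (hP := Allowed.anti F) hm
    obtain ⟨d'⟩ := nonempty_dihedralGroup_mulEquiv_dInfty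
    exact ⟨(mulEquivToEquiv (d.symm.trans d')).comp (codeStructureEquiv F)⟩

/-- Evaluation of Gödel numbers agrees with realization of terms. -/
theorem evalCode_constCode (s : groupLang.Term (codeSet F)) :
    ∃ v, evalCode (constQuad F) (constCode s) = some v ∧
      v.toMotion = (codeEquiv F (s.realize id) : Motion) := by
  let _ := groupStructure (allowedGroup F)
  -- the underlying map of the isomorphism of structures is `codeEquiv`
  have happ : ∀ i, codeEquiv F i = codeStructureEquiv F i := fun _ => rfl
  induction s using term_induction with
  | hvar i =>
    refine ⟨(decodeQuad i).2, by rw [constCode_var, evalCode_cvar, constQuad, if_pos i.2], ?_⟩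
    exact (codeEquiv_apply F i).symm
  | hone =>
    refine ⟨_, by rw [constCode_tone, evalCode_cone], ?_⟩
    rw [realize_tone, happ, map_gone, Quad.toMotion_one]
    rfl
  | hinv s hs =>
    obtain ⟨v, hv, hv'⟩ := hs
    refine ⟨v.inv, by rw [constCode_tinv, evalCode_cinv, hv]; rfl, ?_⟩
    rw [realize_tinv, happ, map_ginv, Quad.toMotion_inv, hv', happ]
    rfl
  | hmul s t hs ht =>
    obtain ⟨v, hv, hv'⟩ := hs
    obtain ⟨w, hw, hw'⟩ := ht
    refine ⟨v.mul w, by rw [constCode_tmul, evalCode_cmul, hv, hw]; rfl, ?_⟩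
    rw [realize_tmul, happ, map_gmul, Quad.toMotion_mul, hv', hw', happ, happ]
    rfl

theorem exists_constCode_of_evalCode {c : ℕ} {v : Quad}
    (h : evalCode (constQuad F) c = some v) : ∃ s : groupLang.Term (codeSet F), c = constCode s := by
  induction c using Nat.strong_induction_on generalizing v with
  | _ c ih =>
    obtain ⟨i, rfl, hi⟩ | rfl | ⟨r, w, rfl, hr⟩ | ⟨r, t, w, w', rfl, hr, ht⟩ :=
      exists_of_evalCode_eq_some h
    · have hi' : i ∈ codeSet F := by
        by_contra hn
        simp [constQuad, hn] at hi
      exact ⟨.var ⟨i, hi'⟩, (constCode_var (⟨i, hi'⟩ : codeSet F)).symm⟩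
    · exact ⟨tone, constCode_tone.symm⟩
    · obtain ⟨s, rfl⟩ := ih r (by
        have := Nat.add_le_pair 2 r
        simp only [cinv]; omega) hr
      exact ⟨tinv s, (constCode_tinv s).symm⟩
    · have h3 := Nat.add_le_pair 3 (Nat.pair r t)
      have h4 := Nat.add_le_pair r t
      obtain ⟨s, rfl⟩ := ih r (by simp only [cmul]; omega) hr
      obtain ⟨t, rfl⟩ := ih t (by simp only [cmul]; omega) ht
      exact ⟨tmul s t, (constCode_tmul s t).symm⟩

/-- The characteristic function of the atomic diagram of `codeSet F`: a (negated) equation is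
decided by evaluating its two sides. -/
noncomputable def diagramChar (F : ℕ → ℕ → Prop) (c : ℕ) : ℕ :=
  ((evalCode (constQuad F) c.unpair.2.unpair.1).bind fun v =>
    (evalCode (constQuad F) c.unpair.2.unpair.2).map fun w =>
      if Quad.Same v w then if c.unpair.1 = 0 then 1 else 0
      else if c.unpair.1 = 1 then 1 else 0).getD 0

theorem diagramChar_eq (c : ℕ) : diagramChar F c = charFun (atomicDiagram (codeSet F)) c := by
  obtain ⟨x, rfl⟩ : ∃ x : ℕ × ℕ × ℕ, c = Nat.pair x.1 (Nat.pair x.2.1 x.2.2) :=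
    ⟨(c.unpair.1, c.unpair.2.unpair), by simp⟩
  obtain ⟨tag, r, t⟩ := x
  simp only [diagramChar, Nat.unpair_pair]
  by_cases h : (∃ s : groupLang.Term (codeSet F), r = constCode s) ∧
      ∃ s : groupLang.Term (codeSet F), t = constCode s
  · obtain ⟨⟨s, rfl⟩, ⟨t, rfl⟩⟩ := h
    obtain ⟨v, hv, hv'⟩ := evalCode_constCode F s
    obtain ⟨w, hw, hw'⟩ := evalCode_constCode F t
    have hsame : Quad.Same v w ↔ s.realize id = t.realize id := by
      rw [Quad.same_iff, hv', hw', Subtype.val_inj, (codeEquiv F).injective.eq_iff]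
    rw [hv, hw]
    simp only [Option.bind_some, Option.map_some, Option.getD_some, hsame]
    match tag with
    | 0 =>
      have := ceq_constCode_mem_iff (s := s) (t := t)
      rw [ceq] at this
      by_cases hst : s.realize id = t.realize id <;> simp [charFun, this, hst]
    | 1 =>
      have := cne_constCode_mem_iff (s := s) (t := t)
      rw [cne] at this
      by_cases hst : s.realize id = t.realize id <;> simp [charFun, this, hst]
    | tag + 2 =>
      have : Nat.pair (tag + 2) (Nat.pair (constCode s) (constCode t)) ∉
          atomicDiagram (codeSet F) := by
        rw [mem_atomicDiagram]
        simp [ceq, cne]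
      simp [charFun, this]
  · have h1 : Nat.pair tag (Nat.pair r t) ∉ atomicDiagram (codeSet F) := by
      rw [mem_atomicDiagram]
      rintro ⟨s, s', ⟨hs, -⟩ | ⟨hs, -⟩⟩ <;>
      · simp only [ceq, cne, Nat.pair_eq_pair] at hs
        exact h ⟨⟨s, hs.2.1⟩, ⟨s', hs.2.2⟩⟩
    rw [charFun, if_neg h1]
    rcases hr : evalCode (constQuad F) r with _ | v
    · rfl
    rcases ht : evalCode (constQuad F) t with _ | w
    · rfl
    exact (h ⟨exists_constCode_of_evalCode F hr, exists_constCode_of_evalCode F ht⟩).elim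

end CodeSet

section Primrec

variable {F : ℕ → ℕ → ℕ → Prop}

@[fun_prop] theorem primrec_decodeQuad {α : Type*} [Primcodable α] {f : α → ℕ} (hf : Primrec f) :
    Primrec fun a => decodeQuad (f a) := by
  have h := (Primrec.ofNat (ℕ × ℕ × ℕ × ℕ × ℕ)).comp hf
  have h' := Primrec.nat_bodd.comp (Primrec.snd.comp (Primrec.snd.comp (Primrec.snd.comp
    (Primrec.snd.comp h))))
  unfold decodeQuad
  exact (Primrec.fst.comp h).pair (Primrec.pair (by fun_prop) (Primrec.pair (by fun_prop)
    (Primrec.pair (by fun_prop) h')))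

theorem primrecRel_exists_lt {β : Type*} [Primcodable β] {R : ℕ → β → Prop} (hR : PrimrecRel R) :
    PrimrecRel fun (n : ℕ) (b : β) => ∃ x < n, R x b :=
  (PrimrecRel.comp (PrimrecRel.exists_mem_list hR) (Primrec.list_range.comp Primrec.fst)
    Primrec.snd).of_eq fun p => by simp

theorem primrecRel_forall_lt {β : Type*} [Primcodable β] {R : ℕ → β → Prop} (hR : PrimrecRel R) :
    PrimrecRel fun (n : ℕ) (b : β) => ∀ x < n, R x b :=
  (PrimrecRel.comp (PrimrecRel.forall_mem_list hR) (Primrec.list_range.comp Primrec.fst)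
    Primrec.snd).of_eq fun p => by simp

theorem primrecPred_valid (hF : PrimrecPred fun x : (ℕ × ℕ) × ℕ => F x.1.1 x.1.2 x.2) :
    PrimrecRel fun n i => Valid (F n) i := by
  have h1 : PrimrecRel fun (y : ℕ) (x : ℕ × ℕ) => F x.1 x.2 y :=
    hF.comp (f := fun p : ℕ × ℕ × ℕ => (p.2, p.1)) (by fun_prop)
  have h2 := PrimrecRel.comp
    (primrecRel_exists_lt (R := fun (y : ℕ) (x : ℕ × ℕ) => F x.1 x.2 y) h1) (f := fun q : ℕ × ℕ × ℕ => q.2.2)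
    (g := fun q => (q.2.1, q.1)) (by fun_prop) (by fun_prop)
  have h3 : PrimrecRel fun (x : ℕ) (p : ℕ × ℕ) => ∃ y < p.2, F p.1 x y := h2
  exact (PrimrecRel.comp (primrecRel_forall_lt
    (R := fun (x : ℕ) (p : ℕ × ℕ) => ∃ y < p.2, F p.1 x y) h3) (f := fun q : ℕ × ℕ => (decodeQuad q.2).2.2.2.1)
    (g := fun q => (q.1, (decodeQuad q.2).1)) (by fun_prop) (by fun_prop) :)

theorem primrecPred_codeSet (hF : PrimrecPred fun x : (ℕ × ℕ) × ℕ => F x.1.1 x.1.2 x.2) :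
    PrimrecPred fun p : ℕ × ℕ => p.2 ∈ codeSet (F p.1) := by
  have hv := primrecPred_valid hF
  have h1 : PrimrecPred fun q : ℕ × ℕ × ℕ =>
      ¬ (Valid (F q.2.1) q.1 ∧ Quad.Same (decodeQuad q.1).2 (decodeQuad q.2.2).2) :=
    ((PrimrecRel.comp hv (f := fun q : ℕ × ℕ × ℕ => q.2.1) (g := fun q => q.1)
      (by fun_prop) (by fun_prop)).and (primrecPred_same (by fun_prop) (by fun_prop))).not
  have h2 : PrimrecRel fun (j : ℕ) (p : ℕ × ℕ) =>
      ¬ (Valid (F p.1) j ∧ Quad.Same (decodeQuad j).2 (decodeQuad p.2).2) := h1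
  have h3 := PrimrecRel.comp (primrecRel_forall_lt (R := fun (j : ℕ) (p : ℕ × ℕ) =>
    ¬ (Valid (F p.1) j ∧ Quad.Same (decodeQuad j).2 (decodeQuad p.2).2)) h2) (f := fun q : ℕ × ℕ => q.2) (g := fun q => q)
    (by fun_prop) (by fun_prop)
  exact PrimrecPred.and hv h3

theorem primrec_diagramChar (hF : PrimrecPred fun x : (ℕ × ℕ) × ℕ => F x.1.1 x.1.2 x.2) :
    Primrec₂ fun n c => diagramChar (F n) c := by
  classical
  have hd : Primrec₂ fun n i => constQuad (F n) i := by
    refine (Primrec.ite (primrecPred_codeSet hF) (f := fun p : ℕ × ℕ => some (decodeQuad p.2).2)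
      (g := fun _ => none) (Primrec.option_some.comp (by fun_prop)) (Primrec.const _)).of_eq
      fun p => rfl
  have he := primrec_evalCode hd
  have h1 : Primrec fun p : ℕ × ℕ => evalCode (constQuad (F p.1)) p.2.unpair.2.unpair.1 :=
    he.comp Primrec.fst (by fun_prop)
  have h2 : Primrec fun p : ℕ × ℕ => evalCode (constQuad (F p.1)) p.2.unpair.2.unpair.2 :=
    he.comp Primrec.fst (by fun_prop)
  refine Primrec.option_getD.comp (Primrec.option_bind h1 (Primrec.option_map (h2.comp Primrec.fst)
    ?_)) (Primrec.const 0)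
  have htag : ∀ i, PrimrecPred fun q : ((ℕ × ℕ) × Quad) × Quad => q.1.1.2.unpair.1 = i := fun i =>
    PrimrecRel.comp Primrec.eq (by fun_prop) (Primrec.const i)
  exact Primrec.ite (primrecPred_same (by fun_prop) (by fun_prop))
    (Primrec.ite (htag 0) (Primrec.const _) (Primrec.const _))
    (Primrec.ite (htag 1) (Primrec.const _) (Primrec.const _))

end Primrec

/-! ### Completeness -/

/-- The atomic diagram determines whether a structure is a copy of the infinite dihedral group. -/
theorem nonempty_equiv_dInfty_congr {B B' : Set ℕ} [groupLang.Structure B] [groupLang.Structure B']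
    (h : atomicDiagram B = atomicDiagram B') :
    Nonempty (B ≃[groupLang] DInfty) ↔ Nonempty (B' ≃[groupLang] DInfty) := by
  rw [nonempty_equiv_dInfty_iff, nonempty_equiv_dInfty_iff, ← rotationClauses_iff,
    ← rotationClauses_iff, ← not_iff_not, not_and_or, not_and_or, ← imprimitiveClauses_iff,
    ← imprimitiveClauses_iff, h]

theorem charFun_injective {D D' : Set ℕ} (h : ∀ n, charFun D n = charFun D' n) : D = D' := by
  ext n
  have := h n
  simp only [charFun] at this
  split_ifs at this <;> simp_all

/-- A `Σ⁰₂` set, as the set of the `n` for which some `x` is not refuted. -/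
theorem IsSigma02.exists_primrecPred {S : Set ℕ} (hS : IsSigma02 S) : ∃ F : ℕ → ℕ → ℕ → Prop,
    (PrimrecPred fun x : (ℕ × ℕ) × ℕ => F x.1.1 x.1.2 x.2) ∧
      ∀ n, n ∈ S ↔ ∃ x, ∀ y, ¬ F n x y := by
  obtain ⟨R, hR, h⟩ := hS
  have h1 : REPred fun p : ℕ × ℕ => ∃ y, ¬ R (p.1, p.2, y) := by
    refine rePred_of_computablePred (ComputablePred.not ?_)
    obtain ⟨_, hR⟩ := hR
    exact Computable.computablePred (hR.comp (g := fun x : (ℕ × ℕ) × ℕ => (x.1.1, x.1.2, x.2))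
      (Primrec.to_comp (by fun_prop)))
  obtain ⟨F, hF, h2⟩ := h1.exists_primrecPred
  refine ⟨fun n x y => F (n, x) y, hF, fun n => ?_⟩
  rw [h]
  refine exists_congr fun x => ?_
  have := h2 (n, x)
  simp only at this
  rw [← not_exists, ← this]
  push Not
  rfl

/-- Given `S₁ \ S₂`, the program attached to `n` computes the atomic diagram of `codeSet`, for the
`Σ⁰₂` question whether `n ∈ S₁`, but gives the `c`-th value only after `c` has been refuted as a
witness of `n ∈ S₂`. So it is total if and only if `n ∉ S₂`. -/
theorem manyOneReducible_indexSet {S : Set ℕ} (hS : IsDSigma02 S) :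
    (fun n => n ∈ S) ≤₀ (fun e => e ∈ indexSet DInfty) := by
  classical
  obtain ⟨S₁, S₂, h₁, h₂, rfl⟩ := hS
  obtain ⟨F, hF, hF'⟩ := h₁.exists_primrecPred
  obtain ⟨G, hG, hG'⟩ := h₂.exists_primrecPred
  let f : ℕ × ℕ →. ℕ := fun p =>
    (Nat.rfind fun y => Part.some (decide (G p.1 p.2 y))).map fun _ => diagramChar (F p.1) p.2
  have hf : Partrec f := by
    refine Partrec.map (Partrec.rfind ?_) ?_
    · exact Computable.partrec hG.computablePred.decide
    · exact (primrec_diagramChar hF).to_comp.comp (Computable.fst.comp Computable.fst)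
        (Computable.snd.comp Computable.fst)
  have hf' : Nat.Partrec fun c => f c.unpair :=
    Partrec.nat_iff.1 (hf.comp Primrec.unpair.to_comp)
  obtain ⟨c, hc⟩ := Nat.Partrec.Code.exists_code.1 hf'
  refine ⟨fun n => Encodable.encode (c.curry n), ?_, fun n => ?_⟩
  · exact (Primrec.encode.comp (Nat.Partrec.Code.primrec₂_curry.comp (Primrec.const c)
      Primrec.id)).to_comp
  have hphi : ∀ x, phi (Encodable.encode (c.curry n)) x = f (n, x) := by
    intro x
    rw [phi, Denumerable.ofNat_encode, Nat.Partrec.Code.eval_curry, hc]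
    simp
  have hdom : ∀ x, (f (n, x)).Dom ↔ ∃ y, G n x y := by
    intro x
    refine Nat.rfind_dom.trans (exists_congr fun y => ?_)
    rw [Part.mem_some_iff, eq_comm, decide_eq_true_iff]
    exact and_iff_left fun _ => trivial
  have hval : ∀ x, (f (n, x)).Dom →
      f (n, x) = Part.some (charFun (atomicDiagram (codeSet (F n))) x) := by
    intro x hx
    refine Part.eq_some_iff.2 ⟨hx, ?_⟩
    rw [← diagramChar_eq]
    rfl
  simp only [Set.mem_sdiff, hF', hG', indexSet]
  push Not
  rw [← nonempty_codeSet_equiv_dInfty_iff]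
  constructor
  · rintro ⟨h, htot⟩
    refine ⟨codeSet (F n), _, h, fun x => ?_⟩
    rw [hphi, hval x ((hdom x).2 (htot x))]
  · rintro ⟨B, inst, hB, h⟩
    have htot : ∀ x, (f (n, x)).Dom := fun x => by rw [← hphi, h]; trivial
    refine ⟨(nonempty_equiv_dInfty_congr (charFun_injective fun x => ?_)).1 hB,
      fun x => (hdom x).1 (htot x)⟩
    have h3 := (hphi x).symm.trans (h x)
    rw [hval x (htot x)] at h3
    exact (Part.some_inj.1 h3).symm

end ScottDihedral

theorem mainTheorem2 :
    (∃ φ : ScottDihedral.InfFormula 0, ScottDihedral.IsComputableDSigma 2 φ ∧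
      ScottDihedral.IsScottSentence.{u, 0} φ ScottDihedral.DInfty) ∧
    ScottDihedral.IsMCompleteDSigma02 (ScottDihedral.indexSet ScottDihedral.DInfty) :=
  ⟨ScottDihedral.exists_scottSentence, ScottDihedral.isDSigma02_indexSet,
    fun _ hS => ScottDihedral.manyOneReducible_indexSet hS⟩
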